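/- Let $T\subseteq\mathbb R^d$ be a Borel set with $0\in T$. Write $\int_T\cdot\,dt$ for integration with respect to Lebesgue measure if $T$ is uncountable, and for $\sum_{t\in T}$ if $T$ is countable. Let $Y=\{Y_t,t\in T\}$ be a stationary centered Gaussian real-valued random function with $\operatorname{Var}Y_t=1$ and measurable covariance function $\rho(t)=\operatorname{Cov}(Y_0,Y_t)$, $t\in T$, such that $|\rho(t)|<1$ for all $t\ne0$ if $T$ is countable, and for Lebesgue-almost every $t\in T$ if $T$ is uncountable. Let $\varphi$ be the standard normal density, $H_n=(-1)^n\varphi^{-1}\varphi^{(n)}$, $n\ge 0$, the Hermite polynomials, and $\langle g,h\rangle_\varphi=\int_{\mathbb R}g(x)h(x)\varphi(x)\,dx$. For a right-continuous strictly monotone function $G:D\to\mathbb R$, where $D=\mathbb R$ or $D=[0,\infty)$, let $\operatorname{Im}(G)=G(D)$ and let $G^-$ be its generalized inverse, $G^-(u)=\inf\{x\in D:G(x)\ge u\}$ if $G$ is increasing and $G^-(u)=\inf\{x\in D:G(x)\le u\}$ if $G$ is decreasing (on $\operatorname{Im}(G)$ this is the inverse function of $G$). For a finite measure $\mu$ on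 $\mathbb R$ and $k\ge0$ put $$b_k(\mu)=\Big(\int_{\operatorname{Im}(G)}H_k(G^-(u))\,\varphi(G^-(u))\,\mu(du)\Big)^2 .$$ A random function $X=\{X_t,t\in T\}$ is called short range dependent (s.r.d.) if for every finite measure $\mu$ on $\mathbb R$ $$\int_T\int_{\mathbb R^2}\big|\operatorname{Cov}\big(\mathbf 1(X_0>u),\mathbf 1(X_t>v)\big)\big|\,\mu(du)\,\mu(dv)\,dt<+\infty .$$ 1. Let $D=\mathbb R$, $G\in C^1(\mathbb R)$, $\operatorname{Im}(G)=\mathbb R$, and let $\mu(dx)=f(x)\,dx$ with $f\in L^1(\mathbb R)$, $f\ge0$. Then, for all integers $k\ge0$, the integral defining $b_k(\mu)$ and the integral $\langle G'f(G),H_k\rangle_\varphi$ converge absolutely and $$b_k(\mu)=\langle G'f(G),H_k\rangle_\varphi^2 .$$ In particular, all $b_k(\mu)$ are finite if $\mathbb E\big[|G'(Y_0)f(G(Y_0))|^{1+\theta}\big]<+\infty$ for some $\theta\in(0,1)$. If $G'f(G)$ is an even function, then $b_k(\mu)=0$ for all odd $k$. 2. Let $D=\mathbb R$ or $D=[0,\infty)$,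 and let $X_t=G(|Y_t|)$, $t\in T$. Then $X$ is s.r.d. if for every finite measure $\mu$ on $\mathbb R$ $$\sum_{k=1}^\infty\frac{b_{2k-1}(\mu)}{(2k)!}\int_T\rho(t)^{2k}\,dt<+\infty ,$$ where a term with $b_{2k-1}(\mu)=0$ is read as $0$. -/

import Mathlib

open MeasureTheory ProbabilityTheory Set

noncomputable section

/-- The probabilists' Hermite polynomial `H_n(x) = (-1)^n φ(x)⁻¹ φ⁽ⁿ⁾(x)` as a real function. -/
def hermiteFun (n : ℕ) (x : ℝ) : ℝ := Polynomial.aeval x (Polynomial.hermite n)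

/-- The standard normal density `φ`. -/
def stdNormalDensity (x : ℝ) : ℝ := gaussianPDFReal 0 1 x

/-- `⟨g, h⟩_φ = ∫ g(x) h(x) φ(x) dx`. -/
def gaussInner (g h : ℝ → ℝ) : ℝ := ∫ x, g x * h x * stdNormalDensity x

open Classical in
/-- The generalized inverse of a strictly monotone function `G` on the set `D`. For increasing `G`
it is `u ↦ inf {x ∈ D : G x ≥ u}`; for decreasing `G` it is the generalized inverse of `-G`
taken at `-u`, that is `u ↦ inf {x ∈ D : G x ≤ u}`. On the image `G(D)` it is the ordinary
inverse of `G` in both cases. -/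
def genInv (D : Set ℝ) (G : ℝ → ℝ) (u : ℝ) : ℝ :=
  if StrictMonoOn G D then sInf {x | x ∈ D ∧ u ≤ G x} else sInf {x | x ∈ D ∧ G x ≤ u}

/-- The integrand `u ↦ H_k(G⁻(u)) φ(G⁻(u))` of the coefficient `b_k(μ)`. -/
def bIntegrand (D : Set ℝ) (G : ℝ → ℝ) (k : ℕ) (u : ℝ) : ℝ :=
  hermiteFun k (genInv D G u) * stdNormalDensity (genInv D G u)

/-- `b_k(μ) = (∫_{G(D)} H_k(G⁻(u)) φ(G⁻(u)) μ(du))²`, where `D` is the domain of `G`. -/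
def bCoeff (D : Set ℝ) (G : ℝ → ℝ) (k : ℕ) (μ : Measure ℝ) : ℝ :=
  (∫ u in G '' D, bIntegrand D G k u ∂μ) ^ 2

open Classical in
/-- The reference measure `dt` on the index set `T ⊆ ℝ^d`: counting measure if `T` is countable
(so that integrals over `T` are sums), and Lebesgue measure otherwise. -/
def indexMeasure {d : ℕ} (T : Set (EuclideanSpace ℝ (Fin d))) : Measure T :=
  if T.Countable then Measure.count else Measure.comap Subtype.val volume

/-- Strict stationarity: finite-dimensional distributions do not change under those shifts which
keep the time points in `T`. -/
def IsStationaryField {d : ℕ} {T : Set (EuclideanSpace ℝ (Fin d))} {Ω : Type*} [MeasurableSpace Ω]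
    (Y : T → Ω → ℝ) (P : Measure Ω) : Prop :=
  ∀ (n : ℕ) (s s' : Fin n → T) (h : EuclideanSpace ℝ (Fin d)),
    (∀ i, (s' i : EuclideanSpace ℝ (Fin d)) = s i + h) →
      P.map (fun ω i => Y (s' i) ω) = P.map (fun ω i => Y (s i) ω)

/-- `ρ(t) = Cov(Y_0, Y_t)`. -/
def corrFun {d : ℕ} {T : Set (EuclideanSpace ℝ (Fin d))} (h0 : 0 ∈ T) {Ω : Type*}
    [MeasurableSpace Ω] (Y : T → Ω → ℝ) (P : Measure Ω) (t : T) : ℝ :=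
  cov[Y ⟨0, h0⟩, Y t; P]

/-- The condition `|ρ(t)| < 1` for all `t ≠ 0` (countable `T`), or for almost every `t`
(uncountable `T`). -/
def RhoCondition {d : ℕ} {T : Set (EuclideanSpace ℝ (Fin d))} (ρ : T → ℝ) : Prop :=
  (T.Countable → ∀ t : T, (t : EuclideanSpace ℝ (Fin d)) ≠ 0 → |ρ t| < 1) ∧
    (¬ T.Countable → ∀ᵐ t ∂(indexMeasure T), |ρ t| < 1)

/-- `Cov_X(t, u, v) = Cov(1(X_0 > u), 1(X_t > v))`. -/
def indicatorCov {d : ℕ} {T : Set (EuclideanSpace ℝ (Fin d))} (h0 : 0 ∈ T) {Ω : Type*}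
    [MeasurableSpace Ω] (X : T → Ω → ℝ) (P : Measure Ω) (t : T) (u v : ℝ) : ℝ :=
  cov[{ω | u < X ⟨0, h0⟩ ω}.indicator (fun _ => (1 : ℝ)),
    {ω | v < X t ω}.indicator (fun _ => (1 : ℝ)); P]

/-- `σ²_{μ,X} = ∫_T ∫_{ℝ²} |Cov_X(t, u, v)| μ(du) μ(dv) dt`, as an extended nonnegative number. -/
def sigmaSq {d : ℕ} {T : Set (EuclideanSpace ℝ (Fin d))} (h0 : 0 ∈ T) {Ω : Type*}
    [MeasurableSpace Ω] (X : T → Ω → ℝ) (P : Measure Ω) (μ : Measure ℝ) : ENNReal :=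
  ∫⁻ t, ∫⁻ p : ℝ × ℝ, ENNReal.ofReal |indicatorCov h0 X P t p.1 p.2| ∂(μ.prod μ) ∂(indexMeasure T)

/-- Short range dependence: `σ²_{μ,X} < ∞` for every finite measure `μ` on `ℝ`. -/
def IsShortRangeDependent {d : ℕ} {T : Set (EuclideanSpace ℝ (Fin d))} (h0 : 0 ∈ T) {Ω : Type*}
    [MeasurableSpace Ω] (X : T → Ω → ℝ) (P : Measure Ω) : Prop :=
  ∀ μ : Measure ℝ, IsFiniteMeasure μ → sigmaSq h0 X P μ < ⊤

/-- The series `∑_{k ≥ 1} b_{2k-1}(μ) / (2k)! · ∫_T ρ(t)^{2k} dt` (indexed by `k + 1`, `k ≥ 0`), as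
an extended nonnegative number; all its terms are nonnegative, and `0 · ∞ = 0`. -/
def evenSeries (D : Set ℝ) (G : ℝ → ℝ) {d : ℕ} {T : Set (EuclideanSpace ℝ (Fin d))} (ρ : T → ℝ)
    (μ : Measure ℝ) : ENNReal :=
  ∑' k : ℕ, ENNReal.ofReal (bCoeff D G (2 * (k + 1) - 1) μ / ((2 * (k + 1)).factorial : ℝ)) *
    ∫⁻ t, ENNReal.ofReal (ρ t ^ (2 * (k + 1))) ∂(indexMeasure T)

end

/-! ### Hermite polynomials under the standard normal law. -/

section Hermite

/-! Part 1 is a change of variables `u = G x`. The functions `H_k φ` are bounded, so the integral in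
`b_k(μ)` converges for every finite `μ`; the Jacobian is `|G'|`, which differs from `G'` by one
global sign, and the square removes that sign. Evenness against odd `H_k` gives the vanishing
coefficients.

Part 2 rests on Mehler's expansion. For a standard Gaussian pair with correlation `|ρ| < 1`, the
joint law has density `∑ ρ^n/n! H_n(x) H_n(y)` with respect to the product of its marginals
(`map_prodMk_real_eq_setIntegral_mehlerKernel`). The indicator of `|x| > a` has vanishing odd
Hermite coefficients, and its coefficient of order `2k ≥ 2` is `2 H_{2k-1}(a) φ(a)`. Hence the
covariance of two such indicators is `4 ∑ ρ^{2k}/(2k)!` times the product of the values of `H_{2k-1}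
φ` at the two levels (`hasSum_covariance_absGtInd`).

This covariance is nonnegative (`covariance_absGtInd_nonneg`), so the absolute value can be dropped
and integration over both levels turns each product into a square (`lintegral_covariance_absGtInd`).

The event `G |Y_t| > u` is, up to a null set, `|Y_t| > a(u)`, its complement, or trivial. Since
`b_k` only sees `G(D)`, and `a(u)` need not be `G⁻(u)`, the hypothesis is applied not to `μ` but to
the image under `G ∘ a` of `μ` restricted to the nontrivial levels: its coefficients are exactly the
squares above (`bCoeff_map`). -/

open Polynomial in
theorem derivative_hermite_succ (n : ℕ) :
    derivative (hermite (n + 1)) = ((n : ℤ[X]) + 1) * hermite n := by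
  induction n with
  | zero => simp
  | succ n ih =>
    rw [hermite_succ (n + 1), derivative_sub, derivative_mul, ih, derivative_mul,
      hermite_succ n]
    simp
    ring

theorem hermiteFun_zero (x : ℝ) : hermiteFun 0 x = 1 := by
  simp [hermiteFun]

theorem hermiteFun_one (x : ℝ) : hermiteFun 1 x = x := by
  simp [hermiteFun]

theorem hermiteFun_add_two (n : ℕ) (x : ℝ) :
    hermiteFun (n + 2) x = x * hermiteFun (n + 1) x - (n + 1) * hermiteFun n x := by
  simp only [hermiteFun]
  rw [Polynomial.hermite_succ (n + 1), derivative_hermite_succ]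
  simp only [map_sub, map_mul, map_add, map_natCast, map_one, Polynomial.aeval_X]

theorem hermiteFun_neg (n : ℕ) (x : ℝ) : hermiteFun n (-x) = (-1) ^ n * hermiteFun n x := by
  induction n using Nat.twoStepInduction with
  | zero => simp [hermiteFun_zero]
  | one => simp [hermiteFun_one]
  | more n h1 h2 =>
    rw [hermiteFun_add_two, hermiteFun_add_two, h1, h2]
    ring

theorem hasDerivAt_hermiteFun_succ (n : ℕ) (x : ℝ) :
    HasDerivAt (hermiteFun (n + 1)) ((n + 1) * hermiteFun n x) x := by
  have := (Polynomial.hermite (n + 1)).hasDerivAt_aeval x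
  rw [derivative_hermite_succ] at this
  simp only [map_mul, map_add, map_natCast, map_one] at this
  exact this

@[fun_prop]
theorem continuous_hermiteFun (n : ℕ) : Continuous (hermiteFun n) := by
  unfold hermiteFun
  fun_prop

theorem stdNormalDensity_eq (x : ℝ) :
    stdNormalDensity x = (√(2 * Real.pi))⁻¹ * Real.exp (-(x ^ 2 / 2)) := by
  simp [stdNormalDensity, gaussianPDFReal, neg_div]

theorem stdNormalDensity_neg (x : ℝ) : stdNormalDensity (-x) = stdNormalDensity x := by
  simp [stdNormalDensity_eq]

theorem stdNormalDensity_nonneg (x : ℝ) : 0 ≤ stdNormalDensity x :=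
  gaussianPDFReal_nonneg 0 1 x

theorem hasDerivAt_stdNormalDensity (x : ℝ) :
    HasDerivAt stdNormalDensity (-(x * stdNormalDensity x)) x := by
  have h : HasDerivAt (fun y : ℝ => -(y ^ 2 / 2)) (-x) x := by
    have := ((hasDerivAt_pow 2 x).div_const 2).fun_neg
    simpa using this
  have h2 := h.exp.const_mul (√(2 * Real.pi))⁻¹
  rw [show stdNormalDensity = fun x => (√(2 * Real.pi))⁻¹ * Real.exp (-(x ^ 2 / 2)) from
    funext stdNormalDensity_eq]
  refine h2.congr_deriv ?_
  ring

@[fun_prop]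
theorem continuous_stdNormalDensity : Continuous stdNormalDensity :=
  continuous_iff_continuousAt.2 fun x => (hasDerivAt_stdNormalDensity x).continuousAt

/-- `(H_n φ)' = -H_{n+1} φ`. -/
theorem hasDerivAt_hermiteFun_mul_density (n : ℕ) (x : ℝ) :
    HasDerivAt (fun y => hermiteFun n y * stdNormalDensity y)
      (-(hermiteFun (n + 1) x * stdNormalDensity x)) x := by
  cases n with
  | zero => simpa [hermiteFun_zero, hermiteFun_one] using hasDerivAt_stdNormalDensity x
  | succ n =>
    refine ((hasDerivAt_hermiteFun_succ n x).mul (hasDerivAt_stdNormalDensity x)).congr_deriv ?_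
    rw [hermiteFun_add_two]
    ring

theorem integrable_gaussianReal_iff {f : ℝ → ℝ} :
    Integrable f (gaussianReal 0 1) ↔ Integrable (fun x => f x * stdNormalDensity x) := by
  rw [gaussianReal_of_var_ne_zero _ one_ne_zero,
    integrable_withDensity_iff (measurable_gaussianPDF 0 1) (ae_of_all _ fun _ => gaussianPDF_lt_top)]
  simp [stdNormalDensity]

theorem integral_gaussianReal_eq (f : ℝ → ℝ) :
    ∫ x, f x ∂(gaussianReal 0 1) = ∫ x, f x * stdNormalDensity x := by
  rw [integral_gaussianReal_eq_integral_smul one_ne_zero]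
  simp [stdNormalDensity, mul_comm]

theorem integrable_aeval_gaussianReal (p : Polynomial ℤ) :
    Integrable (fun x : ℝ => Polynomial.aeval x p) (gaussianReal 0 1) := by
  induction p using Polynomial.induction_on' with
  | add p q hp hq => simpa using hp.fun_add hq
  | monomial n a =>
    have h : Integrable (fun x : ℝ => x ^ n) (gaussianReal 0 1) := by
      have := (memLp_id_gaussianReal (μ := 0) (v := 1) n).integrable_norm_pow' (p := n)
      refine this.mono' (by fun_prop) (ae_of_all _ fun x => ?_)
      simp
    simpa [Polynomial.aeval_monomial] using h.const_mul (a : ℝ)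

theorem integrable_hermiteFun (n : ℕ) : Integrable (hermiteFun n) (gaussianReal 0 1) :=
  integrable_aeval_gaussianReal _

theorem integrable_hermiteFun_mul (m n : ℕ) :
    Integrable (fun x => hermiteFun m x * hermiteFun n x) (gaussianReal 0 1) := by
  simpa [hermiteFun] using
    integrable_aeval_gaussianReal (Polynomial.hermite m * Polynomial.hermite n)

theorem integrable_hermiteFun_mul_density (n : ℕ) :
    Integrable (fun x => hermiteFun n x * stdNormalDensity x) :=
  integrable_gaussianReal_iff.1 (integrable_hermiteFun n)

/-- Integration by parts with `(H_n φ)' = -H_{n+1} φ` and `H_{n+1}' = (n+1) H_n` multiplies the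
value by `n + 1` at each step. -/
theorem integral_hermiteFun_sq (n : ℕ) :
    ∫ x, hermiteFun n x ^ 2 ∂(gaussianReal 0 1) = (n.factorial : ℝ) := by
  induction n with
  | zero => simp [hermiteFun_zero]
  | succ n ih =>
    have h1 : Integrable
        (fun x => hermiteFun (n + 1) x * -(hermiteFun (n + 1) x * stdNormalDensity x)) := by
      simpa [mul_assoc] using (integrable_gaussianReal_iff.1
        (integrable_hermiteFun_mul (n + 1) (n + 1))).neg
    have h2 : Integrable
        (fun x => ((n : ℝ) + 1) * hermiteFun n x * (hermiteFun n x * stdNormalDensity x)) := by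
      simpa [mul_assoc] using (integrable_gaussianReal_iff.1
        (integrable_hermiteFun_mul n n)).const_mul ((n : ℝ) + 1)
    have h3 : Integrable (fun x => hermiteFun (n + 1) x * (hermiteFun n x * stdNormalDensity x)) := by
      simpa [mul_assoc] using integrable_gaussianReal_iff.1 (integrable_hermiteFun_mul (n + 1) n)
    have := integral_mul_deriv_eq_deriv_mul_of_integrable
      (fun x _ => hasDerivAt_hermiteFun_succ n x)
      (fun x _ => hasDerivAt_hermiteFun_mul_density n x) h1 h2 h3
    rw [integral_gaussianReal_eq] at ih ⊢
    rw [Nat.factorial_succ]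
    push_cast
    rw [← ih, ← integral_const_mul]
    simp only [mul_neg, integral_neg, neg_inj] at this
    calc _ = ∫ x, hermiteFun (n + 1) x * (hermiteFun (n + 1) x * stdNormalDensity x) := by
          congr with x; ring
      _ = _ := this
      _ = _ := by congr with x; ring

/-- The variance of `|H_n|` is nonnegative. This bound makes the Mehler series converge in `L¹`. -/
theorem integral_abs_hermiteFun_le (n : ℕ) :
    ∫ x, |hermiteFun n x| ∂(gaussianReal 0 1) ≤ √(n.factorial : ℝ) := by
  apply Real.le_sqrt_of_sq_le
  rw [← integral_hermiteFun_sq n]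
  have hm : MemLp (fun x => |hermiteFun n x|) 2 (gaussianReal 0 1) := by
    rw [memLp_two_iff_integrable_sq (by fun_prop)]
    simpa [sq] using integrable_hermiteFun_mul n n
  have := variance_nonneg (fun x => |hermiteFun n x|) (gaussianReal 0 1)
  rw [variance_eq_sub hm] at this
  simpa using this

theorem tendsto_hermiteFun_mul_density_atTop (n : ℕ) :
    Filter.Tendsto (fun x => hermiteFun n x * stdNormalDensity x) Filter.atTop (nhds 0) :=
  tendsto_zero_of_hasDerivAt_of_integrableOn_Ioi (a := 0)
    (fun x _ => hasDerivAt_hermiteFun_mul_density n x)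
    (integrable_hermiteFun_mul_density (n + 1)).neg.integrableOn
    (integrable_hermiteFun_mul_density n).integrableOn

theorem integral_Ioi_hermiteFun (n : ℕ) (a : ℝ) :
    ∫ x in Ioi a, hermiteFun (n + 1) x * stdNormalDensity x =
      hermiteFun n a * stdNormalDensity a := by
  have := integral_Ioi_of_hasDerivAt_of_tendsto' (a := a)
    (fun x _ => hasDerivAt_hermiteFun_mul_density n x)
    (integrable_hermiteFun_mul_density (n + 1)).neg.integrableOn
    (tendsto_hermiteFun_mul_density_atTop n)
  rw [integral_neg] at this
  linarith

theorem integral_Iio_neg_hermiteFun (n : ℕ) (a : ℝ) :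
    ∫ x in Iio (-a), hermiteFun (n + 1) x * stdNormalDensity x =
      (-1) ^ (n + 1) * (hermiteFun n a * stdNormalDensity a) := by
  rw [← integral_Ioi_hermiteFun, ← integral_const_mul, ← integral_Iic_eq_integral_Iio,
    ← integral_comp_neg_Ioi]
  simp [hermiteFun_neg, stdNormalDensity_neg, mul_assoc]

/-- `H_n φ` at `a` is a tail integral of `H_{n+1} φ`, hence at most the first absolute moment of
`H_{n+1}`. For `n = 2k - 1` the square of the bound is `(2k)!`, the denominator in the covariance
series. -/
theorem abs_hermiteFun_mul_density_le (n : ℕ) (a : ℝ) :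
    |hermiteFun n a * stdNormalDensity a| ≤ √((n + 1).factorial : ℝ) := by
  rw [← integral_Ioi_hermiteFun]
  refine le_trans ?_ (integral_abs_hermiteFun_le (n + 1))
  rw [integral_gaussianReal_eq]
  refine (abs_integral_le_integral_abs).trans ?_
  have h : ∀ x, |hermiteFun (n + 1) x * stdNormalDensity x| =
    |hermiteFun (n + 1) x| * stdNormalDensity x := fun x => by
      rw [abs_mul, abs_of_nonneg (stdNormalDensity_nonneg x)]
  simp_rw [← h]
  exact setIntegral_le_integral (integrable_hermiteFun_mul_density (n + 1)).abs
    (ae_of_all _ fun x => abs_nonneg _)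

/-- The Hermite coefficients of the indicator of the complement of `[-a, a]`. -/
theorem setIntegral_abs_gt_hermiteFun (n : ℕ) {a : ℝ} (ha : 0 ≤ a) :
    ∫ x in {x | a < |x|}, hermiteFun (n + 1) x ∂(gaussianReal 0 1) =
      (1 + (-1) ^ (n + 1)) * (hermiteFun n a * stdNormalDensity a) := by
  have hm : MeasurableSet {x : ℝ | a < |x|} := measurableSet_lt measurable_const (by fun_prop)
  have hs : {x : ℝ | a < |x|} = Ioi a ∪ Iio (-a) := by
    ext x
    simp only [mem_ofPred_eq, mem_union, mem_Ioi, mem_Iio, lt_abs]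
    constructor <;> rintro (h | h) <;> first | (left; linarith) | (right; linarith)
  have hd : Disjoint (Ioi a) (Iio (-a)) := by
    rw [Set.disjoint_left]
    intro x hx hx'
    simp only [mem_Ioi, mem_Iio] at hx hx'
    linarith
  rw [← integral_indicator hm, integral_gaussianReal_eq]
  simp_rw [← indicator_mul_left]
  rw [integral_indicator hm, hs, setIntegral_union hd measurableSet_Iio
    (integrable_hermiteFun_mul_density _).integrableOn
    (integrable_hermiteFun_mul_density _).integrableOn, integral_Ioi_hermiteFun,
    integral_Iio_neg_hermiteFun]
  ring

-- Each integration by parts moves a derivative onto the exponential and yields a factor `s * I`;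
-- for `n = 0` this is the normal characteristic function.
open Complex in
theorem integral_hermiteFun_mul_cexp (n : ℕ) (s : ℝ) :
    ∫ x, (hermiteFun n x : ℂ) * cexp (s * x * I) ∂(gaussianReal 0 1) =
      (s * I) ^ n * cexp (-(s ^ 2 / 2)) := by
  have hint : ∀ m, Integrable (fun x : ℝ => cexp (s * x * I) *
      ((hermiteFun m x * stdNormalDensity x : ℝ) : ℂ)) := by
    intro m
    refine (integrable_hermiteFun_mul_density m).ofReal.bdd_mul (c := 1) (by fun_prop)
      (ae_of_all _ fun x => ?_)
    rw [← ofReal_mul, norm_exp_ofReal_mul_I]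
  have hconv : ∀ m, ∫ x, (hermiteFun m x : ℂ) * cexp (s * x * I) ∂(gaussianReal 0 1) =
      ∫ x : ℝ, cexp (s * x * I) * ((hermiteFun m x * stdNormalDensity x : ℝ) : ℂ) := by
    intro m
    rw [integral_gaussianReal_eq_integral_smul one_ne_zero]
    congr with x
    simp [stdNormalDensity]
    ring
  induction n with
  | zero =>
    have := charFun_gaussianReal (μ := 0) (v := 1) s
    rw [charFun_apply_real] at this
    simp [hermiteFun_zero, this]
  | succ n ih =>
    have hu : ∀ x : ℝ, HasDerivAt (fun x : ℝ => cexp (s * x * I)) (s * I * cexp (s * x * I)) x := by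
      intro x
      have h : HasDerivAt (fun x : ℝ => (s * x * I : ℂ)) (s * I) x := by
        simpa using ((hasDerivAt_id x).ofReal_comp.const_mul (s : ℂ)).mul_const I
      simpa [mul_comm] using h.cexp
    have := integral_mul_deriv_eq_deriv_mul_of_integrable (fun x _ => hu x)
      (fun x _ => (hasDerivAt_hermiteFun_mul_density n x).ofReal_comp)
      ((hint (n + 1)).neg.congr (ae_of_all _ fun x => by simp))
      (((hint n).const_mul (s * I : ℂ)).congr (ae_of_all _ fun x => by simp; ring)) (hint n)
    rw [hconv] at ih ⊢
    simp only [ofReal_neg, mul_neg, integral_neg, neg_inj] at this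
    rw [this, pow_succ', mul_assoc, ← ih, ← integral_const_mul]
    congr with x
    ring

end Hermite

/-! ### The Mehler kernel and termwise integration. -/

section Mehler

theorem integrable_tsum_of_summable_integral_norm {α : Type*} [MeasurableSpace α] {μ : Measure α}
    {F : ℕ → α → ℝ} (hF : ∀ n, Integrable (F n) μ) (hs : Summable fun n => ∫ a, ‖F n a‖ ∂μ) :
    Integrable (fun a => ∑' n, F n a) μ := by
  refine ⟨(AEMeasurable.tsum fun n => (hF n).aemeasurable).aestronglyMeasurable, ?_⟩
  calc ∫⁻ a, ‖∑' n, F n a‖ₑ ∂μ ≤ ∫⁻ a, ∑' n, ‖F n a‖ₑ ∂μ := lintegral_mono fun a => enorm_tsum_le_tsum_enorm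
    _ = ∑' n, ∫⁻ a, ‖F n a‖ₑ ∂μ := lintegral_tsum fun n => (hF n).aemeasurable.enorm
    _ = ∑' n, ENNReal.ofReal (∫ a, ‖F n a‖ ∂μ) := by
        congr with n
        rw [ofReal_integral_norm_eq_lintegral_enorm (hF n)]
    _ < ⊤ := hs.tsum_ofReal_lt_top

/-- The Mehler kernel: the density of the bivariate normal law with correlation `ρ` with respect
to the product of its marginals. -/
noncomputable def mehlerKernel (ρ : ℝ) (p : ℝ × ℝ) : ℝ :=
  ∑' n : ℕ, ρ ^ n / (n.factorial : ℝ) * (hermiteFun n p.1 * hermiteFun n p.2)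

theorem integrable_mehler_term (ρ : ℝ) (n : ℕ) :
    Integrable (fun p : ℝ × ℝ => ρ ^ n / (n.factorial : ℝ) * (hermiteFun n p.1 * hermiteFun n p.2))
      ((gaussianReal 0 1).prod (gaussianReal 0 1)) :=
  ((integrable_hermiteFun n).mul_prod (integrable_hermiteFun n)).const_mul _

theorem integral_norm_mehler_term_le (ρ : ℝ) (n : ℕ) :
    ∫ p : ℝ × ℝ, ‖ρ ^ n / (n.factorial : ℝ) * (hermiteFun n p.1 * hermiteFun n p.2)‖
      ∂((gaussianReal 0 1).prod (gaussianReal 0 1)) ≤ |ρ| ^ n := by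
  simp_rw [norm_mul, Real.norm_eq_abs]
  rw [integral_const_mul, integral_prod_mul (fun x => |hermiteFun n x|) (fun x => |hermiteFun n x|),
    abs_div, abs_pow, Nat.abs_cast, div_mul_eq_mul_div, div_le_iff₀ (by positivity)]
  have h := integral_abs_hermiteFun_le n
  have h0 : 0 ≤ ∫ x, |hermiteFun n x| ∂(gaussianReal 0 1) := integral_nonneg fun x => abs_nonneg _
  refine mul_le_mul_of_nonneg_left ?_ (by positivity)
  calc _ ≤ √(n.factorial : ℝ) * √(n.factorial : ℝ) := mul_le_mul h h h0 (by positivity)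
    _ = _ := Real.mul_self_sqrt (by positivity)

theorem summable_integral_norm_mehler_term {ρ : ℝ} (hρ : |ρ| < 1) :
    Summable fun n : ℕ =>
      ∫ p : ℝ × ℝ, ‖ρ ^ n / (n.factorial : ℝ) * (hermiteFun n p.1 * hermiteFun n p.2)‖
        ∂((gaussianReal 0 1).prod (gaussianReal 0 1)) :=
  Summable.of_nonneg_of_le (fun _ => integral_nonneg fun _ => norm_nonneg _)
    (integral_norm_mehler_term_le ρ) (summable_geometric_of_lt_one (abs_nonneg ρ) hρ)

theorem integrable_mehlerKernel {ρ : ℝ} (hρ : |ρ| < 1) :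
    Integrable (mehlerKernel ρ) ((gaussianReal 0 1).prod (gaussianReal 0 1)) :=
  integrable_tsum_of_summable_integral_norm (integrable_mehler_term ρ)
    (summable_integral_norm_mehler_term hρ)

/-- The `L¹` norms of the terms are at most `|ρ|^n`, and bounded factors do not spoil this. The
scalar field is left open because complex exponentials serve to identify the law and real indicators
to compute covariances. -/
theorem hasSum_integral_mehlerKernel {𝕜 : Type*} [RCLike 𝕜] {ρ : ℝ} (hρ : |ρ| < 1)
    {g₁ g₂ : ℝ → 𝕜} (hg₁ : Measurable g₁) (hg₂ : Measurable g₂) (hb₁ : ∀ x, ‖g₁ x‖ ≤ 1)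
    (hb₂ : ∀ x, ‖g₂ x‖ ≤ 1) :
    HasSum (fun n : ℕ => ((ρ ^ n / (n.factorial : ℝ) : ℝ) : 𝕜) *
        ((∫ x, (hermiteFun n x : 𝕜) * g₁ x ∂(gaussianReal 0 1)) *
          ∫ x, (hermiteFun n x : 𝕜) * g₂ x ∂(gaussianReal 0 1)))
      (∫ p, (mehlerKernel ρ p : 𝕜) * (g₁ p.1 * g₂ p.2)
        ∂((gaussianReal 0 1).prod (gaussianReal 0 1))) := by
  have hb : ∀ p : ℝ × ℝ, ‖g₁ p.1 * g₂ p.2‖ ≤ 1 := fun p => by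
    rw [norm_mul]
    exact mul_le_one₀ (hb₁ _) (norm_nonneg _) (hb₂ _)
  have hint : ∀ n, Integrable (fun p : ℝ × ℝ =>
      ((ρ ^ n / (n.factorial : ℝ) * (hermiteFun n p.1 * hermiteFun n p.2) : ℝ) : 𝕜) *
        (g₁ p.1 * g₂ p.2)) ((gaussianReal 0 1).prod (gaussianReal 0 1)) := fun n =>
    (integrable_mehler_term ρ n).ofReal.mul_bdd (c := 1) (by fun_prop) (ae_of_all _ hb)
  have hsum := hasSum_integral_of_summable_integral_norm hint
    (Summable.of_nonneg_of_le (fun n => integral_nonneg fun p => norm_nonneg _)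
      (fun n => integral_mono (hint n).norm (integrable_mehler_term ρ n).norm fun p => by
        rw [norm_mul, RCLike.norm_ofReal, Real.norm_eq_abs]
        exact mul_le_of_le_one_right (abs_nonneg _) (hb p))
      (summable_integral_norm_mehler_term hρ))
  simp_rw [tsum_mul_right, ← RCLike.ofReal_tsum] at hsum
  refine (congrArg (HasSum · _) (funext fun n => ?_)).mp hsum
  rw [← integral_prod_mul, ← integral_const_mul]
  refine integral_congr_ae (ae_of_all _ fun p => ?_)
  push_cast
  ring

end Mehler

/-! ### The Mehler kernel as a bivariate normal density. -/

section Law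

/-- The sign of `h` is not assumed. Moving its negative part to the other side, `ν + h⁻ m` and `h⁺
m` are finite measures with the same characteristic function, hence equal. -/
theorem measureReal_eq_setIntegral_of_charFunDual {E : Type*} [NormedAddCommGroup E]
    [NormedSpace ℝ E] [CompleteSpace E] [SecondCountableTopology E] [MeasurableSpace E]
    [BorelSpace E] {ν m : Measure E} [IsFiniteMeasure ν] [IsFiniteMeasure m] {h : E → ℝ}
    (hh : Integrable h m)
    (hchar : ∀ L : StrongDual ℝ E,
      charFunDual ν L = ∫ x, (h x : ℂ) * Complex.exp (L x * Complex.I) ∂m)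
    {s : Set E} (hs : MeasurableSet s) : ν.real s = ∫ x in s, h x ∂m := by
  have hfin : ∀ g : E → ℝ, Integrable g m →
      IsFiniteMeasure (m.withDensity fun x => ENNReal.ofReal (g x)) := fun g hg =>
    isFiniteMeasure_withDensity_ofReal hg.2
  have := hfin h hh
  have hn : Integrable (fun x => -h x) m := hh.neg
  have := hfin (fun x => -h x) hn
  have hI : ∀ (g : E → ℝ), Integrable g m → ∀ f : E → ℂ,
      ∫ x, f x ∂(m.withDensity fun x => ENNReal.ofReal (g x)) =
        ∫ x, (max (g x) 0 : ℝ) * f x ∂m := fun g hg f => by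
    rw [integral_withDensity_eq_integral_toReal_smul₀ hg.aemeasurable.ennreal_ofReal
      (ae_of_all _ fun _ => ENNReal.ofReal_lt_top)]
    simp [ENNReal.toReal_ofReal']
  have key : ν + m.withDensity (fun x => ENNReal.ofReal (-h x)) =
      m.withDensity fun x => ENNReal.ofReal (h x) := by
    refine Measure.ext_of_charFunDual (funext fun L => ?_)
    have hbd : ∀ x, ‖Complex.exp (L x * Complex.I)‖ ≤ 1 := fun x => by
      rw [Complex.norm_exp_ofReal_mul_I]
    have hint : ∀ μ : Measure E, IsFiniteMeasure μ →
        Integrable (fun x => Complex.exp (L x * Complex.I)) μ := fun μ _ =>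
      Integrable.of_bound (by fun_prop) 1 (ae_of_all _ hbd)
    have hmul : ∀ g : E → ℝ, Integrable g m →
        Integrable (fun x => (g x : ℂ) * Complex.exp (L x * Complex.I)) m := fun g hg =>
      hg.ofReal.mul_bdd (c := 1) (by fun_prop) (ae_of_all _ hbd)
    have hL := hchar L
    rw [charFunDual_apply] at hL
    rw [charFunDual_apply, charFunDual_apply, integral_add_measure (hint _ inferInstance)
      (hint _ inferInstance), hI _ hh, hI _ hn, hL, ← integral_add (hmul _ hh)
      (hmul _ hn.pos_part)]
    congr with x
    rw [← add_mul, ← Complex.ofReal_add]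
    congr 2
    rcases le_total 0 (h x) with h0 | h0
    · rw [max_eq_right (by simpa using h0), max_eq_left h0, add_zero]
    · rw [max_eq_left (by simpa using h0), max_eq_right h0]
      simp
  have hreal : ∀ g : E → ℝ, Integrable g m →
      (m.withDensity fun x => ENNReal.ofReal (g x)).real s = ∫ x in s, max (g x) 0 ∂m := by
    intro g hg
    rw [measureReal_def, withDensity_apply _ hs, integral_eq_lintegral_of_nonneg_ae
      (f := fun x => max (g x) 0) (ae_of_all _ fun x => le_max_right (g x) 0) hg.pos_part.integrableOn.aestronglyMeasurable]
    simp [ENNReal.ofReal_max]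
  have h1 : ν.real s + (m.withDensity fun x => ENNReal.ofReal (-h x)).real s =
      (m.withDensity fun x => ENNReal.ofReal (h x)).real s := by
    rw [← key, measureReal_add_apply]
  rw [hreal _ hh, hreal _ hn] at h1
  rw [eq_sub_of_add_eq h1, ← integral_sub hh.pos_part.integrableOn hn.pos_part.integrableOn]
  congr with x
  rcases le_total 0 (h x) with h0 | h0
  · rw [max_eq_right (a := -h x) (by simpa using h0), max_eq_left h0, sub_zero]
  · rw [max_eq_left (a := -h x) (by simpa using h0), max_eq_right h0]
    simp

variable {Ω : Type*} [MeasurableSpace Ω] {P : Measure Ω} {U V : Ω → ℝ}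

theorem charFunDual_map_prodMk_of_standard (hUV : HasGaussianLaw (fun ω => (U ω, V ω)) P)
    (hU : P[U] = 0) (hV : P[V] = 0) (hU1 : variance U P = 1) (hV1 : variance V P = 1)
    (L : StrongDual ℝ (ℝ × ℝ)) :
    charFunDual (P.map fun ω => (U ω, V ω)) L =
      Complex.exp (-((L (1, 0) ^ 2 + L (0, 1) ^ 2 + 2 * cov[U, V; P] * (L (1, 0) * L (0, 1)) : ℝ) : ℂ) / 2) := by
  have := hUV.isProbabilityMeasure
  have hLc : ∀ p : ℝ × ℝ, L p = L (1, 0) * p.1 + L (0, 1) * p.2 := by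
    intro p
    have : p = p.1 • ((1 : ℝ), (0 : ℝ)) + p.2 • ((0 : ℝ), (1 : ℝ)) := by ext <;> simp
    conv_lhs => rw [this]
    rw [map_add, map_smul, map_smul]
    simp [mul_comm]
  have hUm := hUV.fst.memLp_two
  have hVm := hUV.snd.memLp_two
  have hcomp : (L ∘ fun ω => (U ω, V ω)) = fun ω => L (1, 0) * U ω + L (0, 1) * V ω :=
    funext fun ω => hLc _
  rw [hUV.charFunDual_map_eq, hcomp, integral_add (hUV.fst.integrable.const_mul _)
    (hUV.snd.integrable.const_mul _), integral_const_mul, integral_const_mul,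
    variance_fun_add (hUm.const_mul _) (hVm.const_mul _), variance_const_mul, variance_const_mul,
    covariance_const_mul_left, covariance_const_mul_right, hU, hV, hU1, hV1]
  congr 1
  push_cast
  ring

/-- Integrating the kernel termwise against an exponential gives the power series of the cross
factor `exp(-ρ s t)` times the two marginal characteristic functions. -/
theorem map_prodMk_real_eq_setIntegral_mehlerKernel
    (hUV : HasGaussianLaw (fun ω => (U ω, V ω)) P)
    (hU : P[U] = 0) (hV : P[V] = 0) (hU1 : variance U P = 1) (hV1 : variance V P = 1)
    (hρ : |cov[U, V; P]| < 1) {s : Set (ℝ × ℝ)} (hs : MeasurableSet s) :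
    (P.map fun ω => (U ω, V ω)).real s =
      ∫ p in s, mehlerKernel cov[U, V; P] p ∂((gaussianReal 0 1).prod (gaussianReal 0 1)) := by
  have := hUV.isProbabilityMeasure
  have := Measure.isProbabilityMeasure_map (μ := P) hUV.aemeasurable
  refine measureReal_eq_setIntegral_of_charFunDual (integrable_mehlerKernel hρ) (fun L => ?_) hs
  have hLc : ∀ p : ℝ × ℝ, L p = L (1, 0) * p.1 + L (0, 1) * p.2 := by
    intro p
    have : p = p.1 • ((1 : ℝ), (0 : ℝ)) + p.2 • ((0 : ℝ), (1 : ℝ)) := by ext <;> simp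
    conv_lhs => rw [this]
    rw [map_add, map_smul, map_smul]
    simp [mul_comm]
  rw [charFunDual_map_prodMk_of_standard hUV hU hV hU1 hV1]
  generalize cov[U, V; P] = ρ at *
  have hb : ∀ c x : ℝ, ‖Complex.exp (c * x * Complex.I)‖ ≤ 1 := fun c x => by
    rw [← Complex.ofReal_mul, Complex.norm_exp_ofReal_mul_I]
  have hsum := hasSum_integral_mehlerKernel (𝕜 := ℂ) hρ
    (g₁ := fun x => Complex.exp (L (1, 0) * x * Complex.I))
    (g₂ := fun x => Complex.exp (L (0, 1) * x * Complex.I)) (by fun_prop) (by fun_prop)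
    (hb _) (hb _)
  simp only [RCLike.ofReal_eq_complex_ofReal, integral_hermiteFun_mul_cexp] at hsum
  have hexp : ∀ p : ℝ × ℝ, Complex.exp (L (1, 0) * p.1 * Complex.I) *
      Complex.exp (L (0, 1) * p.2 * Complex.I) = Complex.exp (L p * Complex.I) := by
    intro p
    rw [← Complex.exp_add, hLc p]
    congr 1
    push_cast
    ring
  simp_rw [hexp] at hsum
  refine HasSum.unique ?_ hsum
  have h := (NormedSpace.expSeries_div_hasSum_exp (𝔸 := ℂ) (-(ρ * (L (1, 0) * L (0, 1)) : ℂ))).mul_right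
    (Complex.exp (-((L (1, 0)) ^ 2 / 2)) * Complex.exp (-((L (0, 1)) ^ 2 / 2)))
  rw [← Complex.exp_eq_exp_ℂ] at h
  have hval : Complex.exp (-((L (1, 0) ^ 2 + L (0, 1) ^ 2 + 2 * ρ * (L (1, 0) * L (0, 1)) : ℝ) : ℂ)
      / 2) = Complex.exp (-(ρ * (L (1, 0) * L (0, 1)))) *
        (Complex.exp (-((L (1, 0)) ^ 2 / 2)) * Complex.exp (-((L (0, 1)) ^ 2 / 2))) := by
    rw [← Complex.exp_add, ← Complex.exp_add]
    congr 1
    push_cast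
    ring
  rw [hval]
  refine (congrArg (HasSum · _) (funext fun n => ?_)).mp h
  have : (-(ρ * (L (1, 0) * L (0, 1)) : ℂ)) ^ n =
      ρ ^ n * ((L (1, 0) * Complex.I) ^ n * (L (0, 1) * Complex.I) ^ n) := by
    rw [← mul_pow, ← mul_pow]
    congr 1
    linear_combination (-(ρ * (L (1, 0) * L (0, 1)) : ℂ)) * Complex.I_sq
  rw [this]
  push_cast
  ring

end Law

/-! ### Covariance of two-sided exceedances: sign and Hermite expansion. -/

section Correlation

theorem gaussianPDFReal_le_of_abs_le (v : NNReal) {x y : ℝ} (h : |x| ≤ |y|) :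
    gaussianPDFReal 0 v y ≤ gaussianPDFReal 0 v x := by
  simp only [gaussianPDFReal, sub_zero]
  have : x ^ 2 ≤ y ^ 2 := sq_le_sq.2 h
  gcongr

theorem gaussianPDFReal_zero_neg (v : NNReal) (x : ℝ) :
    gaussianPDFReal 0 v (-x) = gaussianPDFReal 0 v x := by
  simp [gaussianPDFReal]

/-- The mass that a centered normal law gives to the translate by `-m` of a symmetric interval
decreases in `|m|`. -/
theorem gaussianReal_Icc_sub_le {v : NNReal} (hv : v ≠ 0) {b : ℝ} (hb : 0 ≤ b) {m m' : ℝ}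
    (h : |m| ≤ |m'|) :
    (gaussianReal 0 v).real (Icc (-b - m') (b - m')) ≤
      (gaussianReal 0 v).real (Icc (-b - m) (b - m)) := by
  have hc : Continuous (gaussianPDFReal 0 v) := by
    unfold gaussianPDFReal
    fun_prop
  have hq : ∀ m, (gaussianReal 0 v).real (Icc (-b - m) (b - m)) =
      ∫ y in (-b - m)..(b - m), gaussianPDFReal 0 v y := by
    intro m
    rw [measureReal_def, gaussianReal_apply_eq_integral _ hv, ENNReal.toReal_ofReal
      (integral_nonneg fun x => gaussianPDFReal_nonneg _ _ _),
      intervalIntegral.integral_of_le (by linarith), integral_Icc_eq_integral_Ioc]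
  have hsymm : ∀ m, ∫ y in (-b - |m|)..(b - |m|), gaussianPDFReal 0 v y =
      ∫ y in (-b - m)..(b - m), gaussianPDFReal 0 v y := by
    intro m
    rcases abs_choice m with hm | hm
    · rw [hm]
    · rw [hm, show -b - -m = -(b - m) by ring, show b - -m = -(-b - m) by ring,
        ← intervalIntegral.integral_comp_neg]
      simp_rw [gaussianPDFReal_zero_neg]
  set F : ℝ → ℝ := fun x => ∫ y in (0 : ℝ)..x, gaussianPDFReal 0 v y with hF
  have hFd : ∀ x, HasDerivAt F (gaussianPDFReal 0 v x) x := fun x =>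
    (hc.integral_hasStrictDerivAt 0 x).hasDerivAt
  have hFq : ∀ m, ∫ y in (-b - m)..(b - m), gaussianPDFReal 0 v y = F (b - m) - F (-b - m) := by
    intro m
    rw [hF, intervalIntegral.integral_interval_sub_left] <;> exact hc.intervalIntegrable _ _
  have hd : ∀ m, HasDerivAt (fun m => F (b - m) - F (-b - m))
      (-gaussianPDFReal 0 v (b - m) + gaussianPDFReal 0 v (-b - m)) m := by
    intro m
    have h1 : HasDerivAt (fun m => F (b - m)) (-gaussianPDFReal 0 v (b - m)) m :=
      (hFd (b - m)).comp_const_sub b m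
    have h2 : HasDerivAt (fun m => F (-b - m)) (-gaussianPDFReal 0 v (-b - m)) m :=
      (hFd (-b - m)).comp_const_sub (-b) m
    exact (h1.fun_sub h2).congr_deriv (by ring)
  -- For `b, m ≥ 0` one has `|b - m| ≤ |b + m|`, so the density leaving the window at one end is at
  -- least the density entering at the other.
  have hanti : AntitoneOn (fun m => F (b - m) - F (-b - m)) (Ici 0) := by
    refine antitoneOn_of_deriv_nonpos (convex_Ici 0)
      (fun m _ => (hd m).continuousAt.continuousWithinAt)
      (fun m _ => (hd m).differentiableAt.differentiableWithinAt) fun m hm => ?_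
    rw [interior_Ici] at hm
    have hm : 0 < m := hm
    rw [(hd m).deriv]
    have : |b - m| ≤ |-b - m| := by
      rw [← sq_le_sq]
      nlinarith
    linarith [gaussianPDFReal_le_of_abs_le v this]
  rw [hq, hq, ← hsymm m, ← hsymm m', hFq, hFq]
  exact hanti (abs_nonneg m) (abs_nonneg m') h

/-- Chebyshev's association inequality. -/
theorem integral_mul_integral_le_of_monovary {α : Type*} [MeasurableSpace α] {μ : Measure α}
    [IsProbabilityMeasure μ] {f g : α → ℝ} (hf : Integrable f μ) (hg : Integrable g μ)
    (hfg : Integrable (fun x => f x * g x) μ) (h : Monovary f g) :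
    (∫ x, f x ∂μ) * ∫ x, g x ∂μ ≤ ∫ x, f x * g x ∂μ := by
  have h1 : Integrable (fun p : α × α => f p.1 * g p.1) (μ.prod μ) := hfg.comp_fst μ
  have h2 : Integrable (fun p : α × α => f p.2 * g p.2) (μ.prod μ) := hfg.comp_snd μ
  have h3 : Integrable (fun p : α × α => f p.1 * g p.2) (μ.prod μ) := hf.mul_prod hg
  have h4 : Integrable (fun p : α × α => g p.1 * f p.2) (μ.prod μ) := hg.mul_prod hf
  have hnn : 0 ≤ ∫ p : α × α, (f p.1 - f p.2) * (g p.1 - g p.2) ∂(μ.prod μ) :=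
    integral_nonneg fun p => monovary_iff_forall_mul_nonneg.1 h p.2 p.1
  have heq : ∫ p : α × α, (f p.1 - f p.2) * (g p.1 - g p.2) ∂(μ.prod μ) =
      ∫ p : α × α, (f p.1 * g p.1 + f p.2 * g p.2) - (f p.1 * g p.2 + g p.1 * f p.2)
        ∂(μ.prod μ) := by
    congr with p
    ring
  rw [heq, integral_sub (h1.fun_add h2) (h3.fun_add h4), integral_add h1 h2, integral_add h3 h4,
    integral_fun_fst (fun x => f x * g x), integral_fun_snd (fun x => f x * g x),
    integral_prod_mul f g, integral_prod_mul g f] at hnn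
  simp only [probReal_univ, one_smul] at hnn
  linarith

/-- The indicator function of the complement of `[-a, a]`. -/
noncomputable def absGtInd (a : ℝ) : ℝ → ℝ := {x | a < |x|}.indicator fun _ => 1

theorem measurableSet_abs_gt (a : ℝ) : MeasurableSet {x : ℝ | a < |x|} :=
  measurableSet_lt measurable_const (by fun_prop)

@[fun_prop]
theorem measurable_absGtInd (a : ℝ) : Measurable (absGtInd a) :=
  measurable_const.indicator (measurableSet_abs_gt a)

theorem absGtInd_nonneg (a x : ℝ) : 0 ≤ absGtInd a x := indicator_nonneg (fun _ _ => zero_le_one) x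

theorem norm_absGtInd_le (a x : ℝ) : ‖absGtInd a x‖ ≤ 1 := by
  by_cases h : a < |x| <;> simp [absGtInd, h]

theorem absGtInd_eq_one_sub (a x : ℝ) :
    absGtInd a x = 1 - (Icc (-a) a).indicator (fun _ => (1 : ℝ)) x := by
  by_cases h : a < |x|
  · have : ¬ (-a ≤ x ∧ x ≤ a) := by rwa [← abs_le, not_le]
    simp [absGtInd, h, this]
  · have : -a ≤ x ∧ x ≤ a := by rwa [← abs_le, ← not_lt]
    simp [absGtInd, h, this]

variable {Ω : Type*} [MeasurableSpace Ω] {P : Measure Ω} {U V : Ω → ℝ}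

theorem memLp_absGtInd_comp [IsFiniteMeasure P] (hU : AEMeasurable U P) (a : ℝ) :
    MemLp (fun ω => absGtInd a (U ω)) 2 P :=
  MemLp.of_bound ((measurable_absGtInd a).comp_aemeasurable hU).aestronglyMeasurable 1
    (ae_of_all _ fun ω => norm_absGtInd_le a (U ω))

theorem map_eq_standard_gaussianReal (hU : HasGaussianLaw U P) (h0 : P[U] = 0)
    (h1 : variance U P = 1) : P.map U = gaussianReal 0 1 := by
  rw [hU.map_eq_gaussianReal, h0, h1, Real.toNNReal_one]

/-- Write `V = W + ρ U` with `W` independent of `U`. Given `U = x`, the probability of `|V| > b` is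
nondecreasing in `|x|`, as is the indicator of `|x| > a`, so Chebyshev's association inequality
applies. -/
theorem covariance_absGtInd_nonneg (hUV : HasGaussianLaw (fun ω => (U ω, V ω)) P)
    (hU : P[U] = 0) (hV : P[V] = 0) (hU1 : variance U P = 1) (hV1 : variance V P = 1)
    (hρ : |cov[U, V; P]| < 1) {a b : ℝ} (hb : 0 ≤ b) :
    0 ≤ cov[fun ω => absGtInd a (U ω), fun ω => absGtInd b (V ω); P] := by
  have := hUV.isProbabilityMeasure
  set ρ := cov[U, V; P] with hρdef
  have hUm := hUV.fst.memLp_two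
  have hVm := hUV.snd.memLp_two
  set W : Ω → ℝ := fun ω => V ω - ρ * U ω with hW
  have hUW : HasGaussianLaw (fun ω => (U ω, W ω)) P := by
    simpa using hUV.map_fun ((ContinuousLinearMap.fst ℝ ℝ ℝ).prod
      (ContinuousLinearMap.snd ℝ ℝ ℝ - ρ • ContinuousLinearMap.fst ℝ ℝ ℝ))
  have hcov : cov[U, W; P] = 0 := by
    rw [hW, covariance_fun_sub_right hUm hVm (hUm.const_mul _), covariance_const_mul_right,
      covariance_self hUm.aemeasurable, hU1, ← hρdef]
    ring
  have hind := hUW.indepFun_of_covariance_eq_zero hcov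
  have hvar : variance W P = 1 - ρ ^ 2 := by
    rw [hW, variance_fun_sub hVm (hUm.const_mul _), variance_const_mul, covariance_const_mul_right,
      covariance_comm, ← hρdef, hU1, hV1]
    ring
  have hmean : P[W] = 0 := by
    rw [hW, integral_sub hUV.snd.integrable (hUV.fst.integrable.const_mul _), integral_const_mul,
      hU, hV]
    ring
  have hρ2 : 0 < 1 - ρ ^ 2 := by
    have := (sq_lt_one_iff_abs_lt_one ρ).2 hρ
    linarith
  set v : NNReal := (1 - ρ ^ 2).toNNReal with hvdef
  have hv : v ≠ 0 := by simpa [hvdef] using hρ2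
  have hlawW : P.map W = gaussianReal 0 v := by
    rw [hUW.snd.map_eq_gaussianReal, hmean, hvar]
  have hlawU := map_eq_standard_gaussianReal hUV.fst hU hU1
  have hlaw : P.map (fun ω => (U ω, W ω)) = (gaussianReal 0 1).prod (gaussianReal 0 v) := by
    rw [(indepFun_iff_map_prod_eq_prod_map_map hUV.fst.aemeasurable hUW.snd.aemeasurable).1 hind,
      hlawU, hlawW]
  set k : ℝ → ℝ := fun x => ∫ w, absGtInd b (w + ρ * x) ∂(gaussianReal 0 v) with hk
  have hk_eq : ∀ x, k x = 1 - (gaussianReal 0 v).real (Icc (-b - ρ * x) (b - ρ * x)) := by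
    intro x
    have hI : ∀ w, absGtInd b (w + ρ * x) =
        1 - (Icc (-b - ρ * x) (b - ρ * x)).indicator (fun _ => (1 : ℝ)) w := by
      intro w
      rw [absGtInd_eq_one_sub]
      congr 1
      simp only [indicator_apply, mem_Icc, sub_le_iff_le_add, le_sub_iff_add_le]
    simp_rw [hk, hI]
    rw [integral_sub (integrable_const _)
      ((integrable_const _).indicator measurableSet_Icc), integral_indicator_const _ measurableSet_Icc]
    simp
  have hVW : ∀ ω, V ω = W ω + ρ * U ω := fun ω => by simp [hW]
  have hprod : Integrable (fun p : ℝ × ℝ => absGtInd a p.1 * absGtInd b (p.2 + ρ * p.1))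
      ((gaussianReal 0 1).prod (gaussianReal 0 v)) :=
    Integrable.of_bound (by fun_prop) 1 (ae_of_all _ fun p => by
      rw [norm_mul]
      exact mul_le_one₀ (norm_absGtInd_le _ _) (norm_nonneg _) (norm_absGtInd_le _ _))
  have hone : Integrable (fun p : ℝ × ℝ => absGtInd b (p.2 + ρ * p.1))
      ((gaussianReal 0 1).prod (gaussianReal 0 v)) :=
    Integrable.of_bound (Measurable.aestronglyMeasurable (by fun_prop)) 1
      (ae_of_all _ fun p => norm_absGtInd_le _ _)
  have hE1 : P[(fun ω => absGtInd a (U ω)) * fun ω => absGtInd b (V ω)] =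
      ∫ x, absGtInd a x * k x ∂(gaussianReal 0 1) := by
    calc _ = ∫ ω, absGtInd a (U ω) * absGtInd b (W ω + ρ * U ω) ∂P := by simp [hVW]
      _ = ∫ p : ℝ × ℝ, absGtInd a p.1 * absGtInd b (p.2 + ρ * p.1)
            ∂(P.map fun ω => (U ω, W ω)) :=
          (integral_map hUW.aemeasurable (f := fun p : ℝ × ℝ =>
            absGtInd a p.1 * absGtInd b (p.2 + ρ * p.1)) (by fun_prop)).symm
      _ = _ := by
        rw [hlaw, integral_prod _ hprod]
        simp_rw [integral_const_mul, hk]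
  have hE2 : P[fun ω => absGtInd b (V ω)] = ∫ x, k x ∂(gaussianReal 0 1) := by
    calc _ = ∫ ω, absGtInd b (W ω + ρ * U ω) ∂P := by simp [hVW]
      _ = ∫ p : ℝ × ℝ, absGtInd b (p.2 + ρ * p.1) ∂(P.map fun ω => (U ω, W ω)) :=
          (integral_map hUW.aemeasurable (f := fun p : ℝ × ℝ =>
            absGtInd b (p.2 + ρ * p.1)) (Measurable.aestronglyMeasurable (by fun_prop))).symm
      _ = _ := by rw [hlaw, integral_prod _ hone]
  have hE3 : P[fun ω => absGtInd a (U ω)] = ∫ x, absGtInd a x ∂(gaussianReal 0 1) := by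
    rw [← hlawU, integral_map hUV.fst.aemeasurable (by fun_prop)]
  rw [covariance_eq_sub (memLp_absGtInd_comp hUV.fst.aemeasurable a)
    (memLp_absGtInd_comp hUV.snd.aemeasurable b), hE1, hE2, hE3, sub_nonneg]
  have hmono : Monovary (absGtInd a) k := by
    intro x y hxy
    rw [hk_eq, hk_eq] at hxy
    -- By contraposition: `|y| ≤ |x|` gives `|ρ y| ≤ |ρ x|` whatever the sign of `ρ`, hence `k y ≤ k
    -- x`.
    have hlt : |x| < |y| := by
      by_contra hle
      have hle : |ρ * y| ≤ |ρ * x| := by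
        rw [abs_mul, abs_mul]
        exact mul_le_mul_of_nonneg_left (not_lt.1 hle) (abs_nonneg ρ)
      linarith [gaussianReal_Icc_sub_le hv hb hle]
    by_cases h : a < |x|
    · have h' : a < |y| := h.trans hlt
      simp [absGtInd, h, h']
    · simpa [absGtInd, h] using absGtInd_nonneg a y
  refine integral_mul_integral_le_of_monovary
    (Integrable.of_bound (by fun_prop) 1 (ae_of_all _ (norm_absGtInd_le a)))
    hone.integral_prod_left ?_ hmono
  simpa [integral_const_mul] using hprod.integral_prod_left

/-- The Hermite expansion of the covariance of two exceedance indicators. -/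
theorem hasSum_covariance_absGtInd (hUV : HasGaussianLaw (fun ω => (U ω, V ω)) P)
    (hU : P[U] = 0) (hV : P[V] = 0) (hU1 : variance U P = 1) (hV1 : variance V P = 1)
    (hρ : |cov[U, V; P]| < 1) {a b : ℝ} (ha : 0 ≤ a) (hb : 0 ≤ b) :
    HasSum (fun k : ℕ => 4 * (cov[U, V; P] ^ (2 * (k + 1)) / ((2 * (k + 1)).factorial : ℝ)) *
        ((hermiteFun (2 * (k + 1) - 1) a * stdNormalDensity a) *
          (hermiteFun (2 * (k + 1) - 1) b * stdNormalDensity b)))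
      cov[fun ω => absGtInd a (U ω), fun ω => absGtInd b (V ω); P] := by
  have := hUV.isProbabilityMeasure
  have hlawU := map_eq_standard_gaussianReal hUV.fst hU hU1
  have hlawV := map_eq_standard_gaussianReal hUV.snd hV hV1
  have hlaw : P[(fun ω => absGtInd a (U ω)) * fun ω => absGtInd b (V ω)] =
      ∫ p, mehlerKernel cov[U, V; P] p * (absGtInd a p.1 * absGtInd b p.2)
        ∂((gaussianReal 0 1).prod (gaussianReal 0 1)) := by
    have hs : MeasurableSet ({x : ℝ | a < |x|} ×ˢ {x : ℝ | b < |x|}) :=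
      (measurableSet_abs_gt a).prod (measurableSet_abs_gt b)
    have hind : ∀ p : ℝ × ℝ, absGtInd a p.1 * absGtInd b p.2 =
        ({x : ℝ | a < |x|} ×ˢ {x : ℝ | b < |x|}).indicator (fun _ => (1 : ℝ)) p := by
      intro p
      by_cases h1 : a < |p.1| <;> by_cases h2 : b < |p.2| <;>
        simp [absGtInd, mem_prod, h1, h2]
    calc _ = ∫ p : ℝ × ℝ, absGtInd a p.1 * absGtInd b p.2 ∂(P.map fun ω => (U ω, V ω)) :=
          (integral_map hUV.aemeasurable (f := fun p : ℝ × ℝ =>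
            absGtInd a p.1 * absGtInd b p.2) (by fun_prop)).symm
      _ = _ := by
        simp_rw [hind]
        rw [integral_indicator_const _ hs,
          map_prodMk_real_eq_setIntegral_mehlerKernel hUV hU hV hU1 hV1 hρ hs,
          ← integral_indicator hs]
        simp [indicator_apply]
  have hm : ∀ {X : Ω → ℝ}, AEMeasurable X P → P.map X = gaussianReal 0 1 → ∀ c,
      P[fun ω => absGtInd c (X ω)] = ∫ x, absGtInd c x ∂(gaussianReal 0 1) :=
    fun hX hX' c => by rw [← hX', integral_map hX (by fun_prop)]
  have hcoef : ∀ n {c : ℝ}, 0 ≤ c →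
      ∫ x, hermiteFun (n + 1) x * absGtInd c x ∂(gaussianReal 0 1) =
        (1 + (-1) ^ (n + 1)) * (hermiteFun n c * stdNormalDensity c) := by
    intro n c hc
    rw [← setIntegral_abs_gt_hermiteFun n hc, ← integral_indicator (measurableSet_abs_gt c)]
    congr with x
    simp [absGtInd, indicator_apply]
  have hsum := hasSum_integral_mehlerKernel (𝕜 := ℝ) hρ (measurable_absGtInd a)
    (measurable_absGtInd b) (norm_absGtInd_le a) (norm_absGtInd_le b)
  simp only [RCLike.ofReal_real_eq_id, id_eq] at hsum
  -- The term of order zero is the product of the two means; removing it turns the mixed moment into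
  -- the covariance.
  rw [← hlaw, ← hasSum_nat_add_iff' 1] at hsum
  simp only [Finset.range_one, Finset.sum_singleton, pow_zero, Nat.factorial_zero, Nat.cast_one,
    div_one, one_mul, hermiteFun_zero, hcoef _ ha, hcoef _ hb] at hsum
  rw [covariance_eq_sub (memLp_absGtInd_comp hUV.fst.aemeasurable a)
    (memLp_absGtInd_comp hUV.snd.aemeasurable b), hm hUV.fst.aemeasurable hlawU,
    hm hUV.snd.aemeasurable hlawV]
  -- After the shift the Hermite order is `n + 1`. The factor `1 + (-1)^(n+1)` vanishes for even
  -- `n`; for `n = 2k + 1` it equals 2 in each coefficient, whence the 4.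
  have hinj : Function.Injective fun k : ℕ => 2 * k + 1 := fun i j h => by simpa using h
  rw [← hinj.hasSum_iff] at hsum
  · refine (congrArg (HasSum · _) (funext fun k => ?_)).mp hsum
    simp only [Function.comp_apply, show 2 * (k + 1) - 1 = 2 * k + 1 by omega,
      show 2 * k + 1 + 1 = 2 * (k + 1) by ring, pow_mul, neg_one_sq, one_pow]
    ring
  · intro n hn
    have : Odd (n + 1) := by
      rcases Nat.even_or_odd n with h | h
      · exact h.add_one
      · obtain ⟨j, rfl⟩ := h
        exact absurd ⟨j, rfl⟩ hn
    simp [this.neg_one_pow]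

end Correlation

/-! ### The generalized inverse on the image of `G`. -/

section GeneralizedInverse

theorem genInv_apply {D : Set ℝ} {G : ℝ → ℝ} (hG : StrictMonoOn G D ∨ StrictAntiOn G D) {x : ℝ}
    (hx : x ∈ D) : genInv D G (G x) = x := by
  unfold genInv
  split_ifs with h
  · exact IsLeast.csInf_eq ⟨⟨hx, le_rfl⟩, fun y hy => (h.le_iff_le hx hy.1).1 hy.2⟩
  · have h' := hG.resolve_left h
    exact IsLeast.csInf_eq ⟨⟨hx, le_rfl⟩, fun y hy => (h'.le_iff_ge hy.1 hx).1 hy.2⟩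

theorem bIntegrand_apply {D : Set ℝ} {G : ℝ → ℝ} (hG : StrictMonoOn G D ∨ StrictAntiOn G D) {x : ℝ}
    (hx : x ∈ D) (k : ℕ) : bIntegrand D G k (G x) = hermiteFun k x * stdNormalDensity x := by
  rw [bIntegrand, genInv_apply hG hx]

theorem norm_bIntegrand_le (D : Set ℝ) (G : ℝ → ℝ) (k : ℕ) (u : ℝ) :
    ‖bIntegrand D G k u‖ ≤ √((k + 1).factorial : ℝ) :=
  abs_hermiteFun_mul_density_le k _

end GeneralizedInverse

/-! ### Part 1: coefficients of measures with a density. -/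

section Density

variable {G : ℝ → ℝ} {f : ℝ → ℝ}

theorem measurable_genInv_univ (hG : StrictMono G ∨ StrictAnti G) (hr : range G = univ) :
    Measurable (genInv univ G) := by
  have hG' : StrictMonoOn G univ ∨ StrictAntiOn G univ := by simpa using hG
  have hs : Function.Surjective G := range_eq_univ.1 hr
  rcases hG with h | h
  · refine Monotone.measurable fun u v huv => ?_
    obtain ⟨x, rfl⟩ := hs u
    obtain ⟨y, rfl⟩ := hs v
    rw [genInv_apply hG' (mem_univ x), genInv_apply hG' (mem_univ y)]
    exact h.le_iff_le.1 huv
  · refine Antitone.measurable fun u v huv => ?_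
    obtain ⟨x, rfl⟩ := hs u
    obtain ⟨y, rfl⟩ := hs v
    rw [genInv_apply hG' (mem_univ x), genInv_apply hG' (mem_univ y)]
    exact h.le_iff_ge.1 huv

theorem integrable_bIntegrand_withDensity (hG : StrictMono G ∨ StrictAnti G)
    (hr : range G = univ) (hf : Integrable f) (k : ℕ) :
    Integrable (bIntegrand univ G k) (volume.withDensity fun x => ENNReal.ofReal (f x)) := by
  have := isFiniteMeasure_withDensity_ofReal hf.2
  have hm := measurable_genInv_univ hG hr
  refine Integrable.of_bound (Measurable.aestronglyMeasurable ?_) _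
    (ae_of_all _ (norm_bIntegrand_le univ G k))
  exact ((continuous_hermiteFun k).measurable.comp hm).mul
    (continuous_stdNormalDensity.measurable.comp hm)

/-- The change of variables produces `|G'|`; a sign independent of `x` can be pulled out of the
integral and squares away in `b_k`. -/
theorem exists_sign_abs_deriv (hG : StrictMono G ∨ StrictAnti G) :
    ∃ σ : ℝ, σ ^ 2 = 1 ∧ ∀ x, |deriv G x| = σ * deriv G x := by
  rcases hG with h | h
  · exact ⟨1, by norm_num, fun x => by rw [one_mul, abs_of_nonneg h.monotone.deriv_nonneg]⟩
  · exact ⟨-1, by norm_num, fun x => by rw [neg_one_mul, abs_of_nonpos h.antitone.deriv_nonpos]⟩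

theorem integrable_deriv_mul_comp (hG : StrictMono G ∨ StrictAnti G) (hd : Differentiable ℝ G)
    (hr : range G = univ) (hf : Integrable f) (hf0 : ∀ x, 0 ≤ f x) (k : ℕ) :
    Integrable (fun x => deriv G x * f (G x) * hermiteFun k x * stdNormalDensity x) := by
  have hG' : StrictMonoOn G univ ∨ StrictAntiOn G univ := by simpa using hG
  have hinj : Function.Injective G := hG.elim StrictMono.injective StrictAnti.injective
  obtain ⟨σ, hσ, hs⟩ := exists_sign_abs_deriv hG
  have h := integrable_bIntegrand_withDensity hG hr hf k
  rw [integrable_withDensity_iff_integrable_smul₀' hf.aemeasurable.ennreal_ofReal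
    (ae_of_all _ fun _ => ENNReal.ofReal_lt_top), ← integrableOn_univ, ← hr, ← image_univ,
    integrableOn_image_iff_integrableOn_abs_deriv_smul MeasurableSet.univ
      (fun x _ => (hd x).hasDerivAt.hasDerivWithinAt) hinj.injOn, integrableOn_univ] at h
  refine (h.const_mul σ).congr (ae_of_all _ fun x => ?_)
  simp only [image_univ, hr, smul_eq_mul, ENNReal.toReal_ofReal (hf0 _), bIntegrand_apply hG' (mem_univ x), hs]
  linear_combination (deriv G x * f (G x) * hermiteFun k x * stdNormalDensity x) * hσ

theorem bCoeff_withDensity (hG : StrictMono G ∨ StrictAnti G) (hd : Differentiable ℝ G)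
    (hr : range G = univ) (hf : Integrable f) (hf0 : ∀ x, 0 ≤ f x) (k : ℕ) :
    bCoeff univ G k (volume.withDensity fun x => ENNReal.ofReal (f x)) =
      gaussInner (fun x => deriv G x * f (G x)) (hermiteFun k) ^ 2 := by
  have hG' : StrictMonoOn G univ ∨ StrictAntiOn G univ := by simpa using hG
  have hinj : Function.Injective G := hG.elim StrictMono.injective StrictAnti.injective
  obtain ⟨σ, hσ, hs⟩ := exists_sign_abs_deriv hG
  have h : ∫ u in G '' univ, bIntegrand univ G k u
        ∂(volume.withDensity fun x => ENNReal.ofReal (f x)) =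
      σ * gaussInner (fun x => deriv G x * f (G x)) (hermiteFun k) := by
    rw [image_univ, hr, Measure.restrict_univ, integral_withDensity_eq_integral_toReal_smul₀
      hf.aemeasurable.ennreal_ofReal (ae_of_all _ fun _ => ENNReal.ofReal_lt_top),
      ← setIntegral_univ, ← hr, ← image_univ,
      integral_image_eq_integral_abs_deriv_smul MeasurableSet.univ
        (fun x _ => (hd x).hasDerivAt.hasDerivWithinAt) hinj.injOn, setIntegral_univ, gaussInner,
      ← integral_const_mul]
    congr with x
    simp only [image_univ, hr, smul_eq_mul, ENNReal.toReal_ofReal (hf0 _), bIntegrand_apply hG' (mem_univ x), hs]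
    ring
  rw [bCoeff, h, mul_pow, hσ, one_mul]

theorem gaussInner_hermiteFun_eq_zero_of_even {g : ℝ → ℝ} (hg : Function.Even g) {k : ℕ}
    (hk : Odd k) : gaussInner g (hermiteFun k) = 0 := by
  have h : gaussInner g (hermiteFun k) = -gaussInner g (hermiteFun k) := by
    unfold gaussInner
    conv_lhs => rw [← integral_neg_eq_self]
    rw [← integral_neg]
    congr with x
    rw [hg x, hermiteFun_neg, stdNormalDensity_neg, hk.neg_one_pow]
    ring
  linarith

end Density

/-! ### Exceedances of `G |y|` as exceedances of `|y|`. -/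

section ExceedanceLevels

/-- The events `{u < G |y|}` in terms of the levels `a u`: for `u` in `S`, they are up to the
level itself `{a u < |y|}` or, for decreasing `G`, its complement; for `u` outside `S` they are
trivial. -/
theorem exists_levels {G : ℝ → ℝ} (hG : StrictMonoOn G (Ici 0) ∨ StrictAntiOn G (Ici 0)) :
    ∃ (S : Set ℝ) (a : ℝ → ℝ), MeasurableSet S ∧ (∀ u, 0 ≤ a u) ∧
      (MonotoneOn a S ∨ AntitoneOn a S) ∧
      ((∀ x, 0 ≤ x → (∀ u ∈ S, x ≠ a u → (u < G x ↔ a u < x)) ∧ ∀ u ∉ S, ¬ u < G x) ∨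
        ∀ x, 0 ≤ x → (∀ u ∈ S, x ≠ a u → (u < G x ↔ ¬ a u < x)) ∧ ∀ u ∉ S, u < G x) := by
  rcases hG with h | h
  · refine ⟨{u | ∃ x, 0 ≤ x ∧ u ≤ G x}, fun u => sInf {x | 0 ≤ x ∧ u ≤ G x}, ?_,
      fun u => Real.sInf_nonneg fun x hx => hx.1, Or.inl ?_, Or.inl fun x hx => ⟨?_, ?_⟩⟩
    · refine OrdConnected.measurableSet (IsLowerSet.ordConnected ?_)
      rintro u v hvu ⟨x, hx, hux⟩
      exact ⟨x, hx, hvu.trans hux⟩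
    · rintro u - v ⟨x, hx, hvx⟩ huv
      exact csInf_le_csInf ⟨0, fun y hy => hy.1⟩ ⟨x, hx, hvx⟩ fun y hy => ⟨hy.1, huv.trans hy.2⟩
    · rintro u ⟨y, hy, huy⟩ hne
      have hbdd : BddBelow {x | 0 ≤ x ∧ u ≤ G x} := ⟨0, fun y hy => hy.1⟩
      have hset : {x | 0 ≤ x ∧ u ≤ G x}.Nonempty := ⟨y, hy, huy⟩
      constructor
      · intro hux
        exact lt_of_le_of_ne (csInf_le hbdd ⟨hx, hux.le⟩) hne.symm
      · intro hax
        obtain ⟨z, ⟨hz, huz⟩, hzx⟩ := exists_lt_of_csInf_lt hset hax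
        exact huz.trans_lt (h hz hx hzx)
    · intro u hu hux
      exact hu ⟨x, hx, hux.le⟩
  · refine ⟨{u | ∃ x, 0 ≤ x ∧ G x ≤ u}, fun u => sInf {x | 0 ≤ x ∧ G x ≤ u}, ?_,
      fun u => Real.sInf_nonneg fun x hx => hx.1, Or.inr ?_, Or.inr fun x hx => ⟨?_, ?_⟩⟩
    · refine OrdConnected.measurableSet (IsUpperSet.ordConnected ?_)
      rintro u v huv ⟨x, hx, hux⟩
      exact ⟨x, hx, hux.trans huv⟩
    · rintro u ⟨x, hx, hux⟩ v - huv
      exact csInf_le_csInf ⟨0, fun y hy => hy.1⟩ ⟨x, hx, hux⟩ fun y hy => ⟨hy.1, hy.2.trans huv⟩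
    · rintro u ⟨y, hy, huy⟩ hne
      have hbdd : BddBelow {x | 0 ≤ x ∧ G x ≤ u} := ⟨0, fun y hy => hy.1⟩
      have hset : {x | 0 ≤ x ∧ G x ≤ u}.Nonempty := ⟨y, hy, huy⟩
      constructor
      · intro hux hax
        obtain ⟨z, ⟨hz, huz⟩, hzx⟩ := exists_lt_of_csInf_lt hset hax
        exact absurd ((h hz hx hzx).trans_le huz) hux.not_gt
      · intro hax
        by_contra hux
        exact hax (lt_of_le_of_ne (csInf_le hbdd ⟨hx, not_lt.1 hux⟩) hne.symm)
    · intro u hu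
      by_contra hux
      exact hu ⟨x, hx, not_lt.1 hux⟩

/-- Every finite measure on the half-line is carried by `G` to a finite measure whose coefficients
`b_k` are the squared integrals of `H_k φ`. -/
theorem bCoeff_map {D : Set ℝ} (hD : Ici 0 ⊆ D) {G : ℝ → ℝ}
    (hG : StrictMonoOn G D ∨ StrictAntiOn G D) (ν : Measure (Ici (0 : ℝ))) (k : ℕ) :
    bCoeff D G k (ν.map fun x : Ici (0 : ℝ) => G x) =
      (∫ x : Ici (0 : ℝ), hermiteFun k x * stdNormalDensity x ∂ν) ^ 2 := by
  have hmeas : Measurable fun x : Ici (0 : ℝ) => G x := by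
    rcases hG with h | h
    · exact Monotone.measurable fun x y hxy => h.monotoneOn (hD x.2) (hD y.2) hxy
    · exact Antitone.measurable fun x y hxy => h.antitoneOn (hD x.2) (hD y.2) hxy
  have hinj : Function.Injective fun x : Ici (0 : ℝ) => G x := fun x y hxy =>
    Subtype.ext (hG.elim StrictMonoOn.injOn StrictAntiOn.injOn (hD x.2) (hD y.2) hxy)
  -- By Lusin–Souslin an injective Borel map on a standard Borel space is a measurable embedding, so
  -- integrals transfer without any measurability of `bIntegrand`.
  have : StandardBorelSpace (Ici (0 : ℝ)) := measurableSet_Ici.standardBorel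
  have hemb := hmeas.measurableEmbedding hinj
  have hrestr : (ν.map fun x : Ici (0 : ℝ) => G x).restrict (G '' D) =
      ν.map fun x : Ici (0 : ℝ) => G x :=
    Measure.restrict_eq_self_of_ae_mem
      (hemb.ae_map_iff.2 (ae_of_all _ fun x => mem_image_of_mem G (hD x.2)))
  rw [bCoeff, hrestr, hemb.integral_map]
  congr 2 with x
  exact bIntegrand_apply hG (hD x.2) k

end ExceedanceLevels

/-! ### Covariances of exceedance indicators. -/

section IndicatorCovariance

variable {Ω : Type*} [MeasurableSpace Ω] {P : Measure Ω}

theorem covariance_congr_ae {X X' Z Z' : Ω → ℝ} (hX : X =ᵐ[P] X') (hZ : Z =ᵐ[P] Z') :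
    cov[X, Z; P] = cov[X', Z'; P] := by
  unfold covariance
  rw [integral_congr_ae hX, integral_congr_ae hZ]
  refine integral_congr_ae ?_
  filter_upwards [hX, hZ] with ω h1 h2
  rw [h1, h2]

theorem ae_abs_ne_of_map_eq_gaussianReal {U : Ω → ℝ} (hU : AEMeasurable U P)
    (hlaw : P.map U = gaussianReal 0 1) (c : ℝ) : ∀ᵐ ω ∂P, |U ω| ≠ c := by
  have := nullSingletonClass_gaussianReal (μ := 0) (v := 1) one_ne_zero
  have h : ∀ᵐ x ∂(P.map U), x ∉ ({c, -c} : Set ℝ) := by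
    rw [hlaw]
    exact measure_eq_zero_iff_ae_notMem.1 (Set.Finite.measure_zero (by simp) _)
  filter_upwards [ae_of_ae_map hU h] with ω hω hc
  rcases abs_choice (U ω) with h' | h'
  · exact hω (Or.inl (h'.symm.trans hc))
  · refine hω (Or.inr ?_)
    rw [mem_singleton_iff, ← hc, h', neg_neg]

/-- Each centered indicator is bounded by 2. This crude bound settles the origin, where `ρ = 1` and
the Mehler series is unavailable. -/
theorem abs_covariance_indicator_le [IsProbabilityMeasure P] (A B : Set Ω) :
    |cov[A.indicator fun _ => (1 : ℝ), B.indicator fun _ => (1 : ℝ); P]| ≤ 4 := by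
  have hb : ∀ (A : Set Ω) ω, ‖A.indicator (fun _ => (1 : ℝ)) ω‖ ≤ 1 := fun A ω => by
    by_cases h : ω ∈ A <;> simp [h]
  have hi : ∀ A : Set Ω, ‖∫ ω, A.indicator (fun _ => (1 : ℝ)) ω ∂P‖ ≤ 1 := fun A => by
    simpa using norm_integral_le_of_norm_le_const (μ := P) (ae_of_all _ (hb A))
  have hd : ∀ (A : Set Ω) ω, ‖A.indicator (fun _ => (1 : ℝ)) ω -
      ∫ ω, A.indicator (fun _ => (1 : ℝ)) ω ∂P‖ ≤ 2 := fun A ω =>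
    (norm_sub_le _ _).trans (by linarith [hb A ω, hi A])
  have := norm_integral_le_of_norm_le_const (μ := P) (C := 4)
    (f := fun ω => (A.indicator (fun _ => (1 : ℝ)) ω - ∫ ω, A.indicator (fun _ => (1 : ℝ)) ω ∂P) *
      (B.indicator (fun _ => (1 : ℝ)) ω - ∫ ω, B.indicator (fun _ => (1 : ℝ)) ω ∂P))
    (ae_of_all _ fun ω => by
      rw [norm_mul]
      nlinarith [hd A ω, hd B ω, norm_nonneg (A.indicator (fun _ => (1 : ℝ)) ω -
        ∫ ω, A.indicator (fun _ => (1 : ℝ)) ω ∂P), norm_nonneg (B.indicator (fun _ => (1 : ℝ)) ω -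
        ∫ ω, B.indicator (fun _ => (1 : ℝ)) ω ∂P)])
  simpa [covariance] using this

/-- The exceedance indicators of `G |U|` and `G |V|` have the same covariances as those of `|U|`
and `|V|` over the corresponding levels. -/
theorem covariance_exceedance_eq [IsProbabilityMeasure P] {U V : Ω → ℝ} (hU : AEMeasurable U P)
    (hV : AEMeasurable V P) (hUlaw : P.map U = gaussianReal 0 1)
    (hVlaw : P.map V = gaussianReal 0 1) {G : ℝ → ℝ} {S : Set ℝ} {a : ℝ → ℝ}
    (hS : (∀ x, 0 ≤ x → (∀ u ∈ S, x ≠ a u → (u < G x ↔ a u < x)) ∧ ∀ u ∉ S, ¬ u < G x) ∨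
        ∀ x, 0 ≤ x → (∀ u ∈ S, x ≠ a u → (u < G x ↔ ¬ a u < x)) ∧ ∀ u ∉ S, u < G x) (u v : ℝ) :
    (u ∈ S → v ∈ S → cov[{ω | u < G |U ω|}.indicator (fun _ => (1 : ℝ)),
        {ω | v < G |V ω|}.indicator (fun _ => (1 : ℝ)); P] =
      cov[fun ω => absGtInd (a u) (U ω), fun ω => absGtInd (a v) (V ω); P]) ∧
    (u ∉ S ∨ v ∉ S → cov[{ω | u < G |U ω|}.indicator (fun _ => (1 : ℝ)),
        {ω | v < G |V ω|}.indicator (fun _ => (1 : ℝ)); P] = 0) := by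
  have hint : ∀ {X : Ω → ℝ}, AEMeasurable X P → ∀ c, Integrable (fun ω => absGtInd c (X ω)) P :=
    fun hX c => (memLp_absGtInd_comp hX c).integrable one_le_two
  rcases hS with hS | hS
  · have hin : ∀ {X : Ω → ℝ}, AEMeasurable X P → P.map X = gaussianReal 0 1 → ∀ w ∈ S,
        {ω | w < G |X ω|}.indicator (fun _ => (1 : ℝ)) =ᵐ[P] fun ω => absGtInd (a w) (X ω) := by
      intro X hX hXlaw w hw
      filter_upwards [ae_abs_ne_of_map_eq_gaussianReal hX hXlaw (a w)] with ω hω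
      have := (hS |X ω| (abs_nonneg _)).1 w hw hω
      simp [absGtInd, indicator_apply, this]
    have hout : ∀ (X : Ω → ℝ), ∀ w ∉ S,
        {ω | w < G |X ω|}.indicator (fun _ => (1 : ℝ)) = fun _ => 0 := by
      intro X w hw
      ext ω
      simp [(hS |X ω| (abs_nonneg _)).2 w hw]
    refine ⟨fun hu hv => covariance_congr_ae (hin hU hUlaw u hu) (hin hV hVlaw v hv), ?_⟩
    rintro (hu | hv)
    · rw [hout U u hu, covariance_const_left]
    · rw [hout V v hv, covariance_const_right]
  -- For decreasing `G` both events become complements, and the two sign changes in the covariance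
  -- cancel.
  · have hin : ∀ {X : Ω → ℝ}, AEMeasurable X P → P.map X = gaussianReal 0 1 → ∀ w ∈ S,
        {ω | w < G |X ω|}.indicator (fun _ => (1 : ℝ)) =ᵐ[P] fun ω => 1 - absGtInd (a w) (X ω) := by
      intro X hX hXlaw w hw
      filter_upwards [ae_abs_ne_of_map_eq_gaussianReal hX hXlaw (a w)] with ω hω
      have := (hS |X ω| (abs_nonneg _)).1 w hw hω
      by_cases h : a w < |X ω| <;> simp [absGtInd, this, h]
    have hout : ∀ (X : Ω → ℝ), ∀ w ∉ S,
        {ω | w < G |X ω|}.indicator (fun _ => (1 : ℝ)) = fun _ => 1 := by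
      intro X w hw
      ext ω
      simp [(hS |X ω| (abs_nonneg _)).2 w hw]
    refine ⟨fun hu hv => ?_, ?_⟩
    · rw [covariance_congr_ae (hin hU hUlaw u hu) (hin hV hVlaw v hv),
        covariance_const_sub_left (hint hU _), covariance_const_sub_right (hint hV _), neg_neg]
    · rintro (hu | hv)
      · rw [hout U u hu, covariance_const_left]
      · rw [hout V v hv, covariance_const_right]

end IndicatorCovariance

/-! ### Integrating the covariance series over the levels. -/

section Series

variable {Ω : Type*} [MeasurableSpace Ω] {P : Measure Ω} {U V : Ω → ℝ}

/-- Nonnegativity of the covariance removes the absolute value; the `k`-th term is a product in the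
two levels, so Fubini makes its integral a square. -/
theorem lintegral_covariance_absGtInd (hUV : HasGaussianLaw (fun ω => (U ω, V ω)) P)
    (hU : P[U] = 0) (hV : P[V] = 0) (hU1 : variance U P = 1) (hV1 : variance V P = 1)
    (hρ : |cov[U, V; P]| < 1) {m : Measure ℝ} [IsFiniteMeasure m] {a : ℝ → ℝ}
    (ha : ∀ u, 0 ≤ a u) (ham : AEMeasurable a m) :
    ∫⁻ p : ℝ × ℝ, ENNReal.ofReal
        |cov[fun ω => absGtInd (a p.1) (U ω), fun ω => absGtInd (a p.2) (V ω); P]| ∂(m.prod m) =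
      4 * ∑' k : ℕ, ENNReal.ofReal
          ((∫ u, hermiteFun (2 * (k + 1) - 1) (a u) * stdNormalDensity (a u) ∂m) ^ 2 /
            ((2 * (k + 1)).factorial : ℝ)) *
        ENNReal.ofReal (cov[U, V; P] ^ (2 * (k + 1))) := by
  have hsum := fun u v => hasSum_covariance_absGtInd hUV hU hV hU1 hV1 hρ (ha u) (ha v)
  have hnn := fun u v => covariance_absGtInd_nonneg hUV hU hV hU1 hV1 hρ (a := a u) (ha v)
  generalize cov[U, V; P] = ρ at *
  set e : ℕ → ℝ → ℝ := fun k u =>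
    hermiteFun (2 * (k + 1) - 1) (a u) * stdNormalDensity (a u) with he
  set w : ℕ → ℝ := fun k => 4 * (ρ ^ (2 * (k + 1)) / ((2 * (k + 1)).factorial : ℝ)) with hw
  have hpow : ∀ k : ℕ, 0 ≤ ρ ^ (2 * (k + 1)) := fun k => (even_two_mul _).pow_nonneg ρ
  have hw0 : ∀ k, 0 ≤ w k := fun k => by
    have := hpow k
    positivity
  have heb : ∀ k u, ‖e k u‖ ≤ √((2 * (k + 1)).factorial : ℝ) := fun k u => by
    have := abs_hermiteFun_mul_density_le (2 * (k + 1) - 1) (a u)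
    rwa [show 2 * (k + 1) - 1 + 1 = 2 * (k + 1) by omega] at this
  have heint : ∀ k, Integrable (e k) m := fun k => by
    refine Integrable.of_bound (AEMeasurable.aestronglyMeasurable ?_) _ (ae_of_all _ (heb k))
    exact ((continuous_hermiteFun _).measurable.comp_aemeasurable ham).mul
      (continuous_stdNormalDensity.measurable.comp_aemeasurable ham)
  have hFint : ∀ k, Integrable (fun p : ℝ × ℝ => w k * (e k p.1 * e k p.2)) (m.prod m) := fun k =>
    ((heint k).mul_prod (heint k)).const_mul _
  have hFb : ∀ k, ∫ p : ℝ × ℝ, ‖w k * (e k p.1 * e k p.2)‖ ∂(m.prod m) ≤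
      4 * (m.prod m).real univ * (ρ ^ 2) ^ (k + 1) := by
    intro k
    -- The two bounds `√((2k+2)!)` cancel the factorial in `w k`, leaving a geometric series in `ρ ^
    -- 2`.
    have hpt : ∀ p : ℝ × ℝ, ‖w k * (e k p.1 * e k p.2)‖ ≤ 4 * ρ ^ (2 * (k + 1)) := by
      intro p
      rw [norm_mul (w k), norm_mul (e k p.1), Real.norm_of_nonneg (hw0 k)]
      have h1 : ‖e k p.1‖ * ‖e k p.2‖ ≤ ((2 * (k + 1)).factorial : ℝ) := by
        refine (mul_le_mul (heb k _) (heb k _) (norm_nonneg _) (by positivity)).trans_eq ?_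
        exact Real.mul_self_sqrt (by positivity)
      refine (mul_le_mul_of_nonneg_left h1 (hw0 k)).trans_eq ?_
      rw [hw]
      field_simp
    calc _ ≤ ∫ _ : ℝ × ℝ, 4 * ρ ^ (2 * (k + 1)) ∂(m.prod m) :=
          integral_mono (hFint k).norm (integrable_const _) hpt
      _ = _ := by
        rw [integral_const, smul_eq_mul, pow_mul]
        ring
  have hρ2 : ρ ^ 2 < 1 := (sq_lt_one_iff_abs_lt_one ρ).2 hρ
  have hgeo : Summable fun k : ℕ => 4 * (m.prod m).real univ * (ρ ^ 2) ^ (k + 1) :=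
    ((summable_nat_add_iff 1).2 (summable_geometric_of_lt_one (sq_nonneg ρ) hρ2)).mul_left _
  have hFs : Summable fun k => ∫ p : ℝ × ℝ, ‖w k * (e k p.1 * e k p.2)‖ ∂(m.prod m) :=
    Summable.of_nonneg_of_le (fun _ => integral_nonneg fun _ => norm_nonneg _) hFb hgeo
  have hFtsum : ∀ p : ℝ × ℝ, ∑' k, w k * (e k p.1 * e k p.2) =
      cov[fun ω => absGtInd (a p.1) (U ω), fun ω => absGtInd (a p.2) (V ω); P] := fun p =>
    (hsum p.1 p.2).tsum_eq
  have hcint := integrable_tsum_of_summable_integral_norm hFint hFs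
  have hcsum := hasSum_integral_of_summable_integral_norm hFint hFs
  simp_rw [hFtsum] at hcint hcsum
  simp_rw [fun p : ℝ × ℝ => abs_of_nonneg (hnn p.1 p.2)]
  rw [← ofReal_integral_eq_lintegral_ofReal hcint (ae_of_all _ fun p => hnn p.1 p.2),
    ← hcsum.tsum_eq]
  simp_rw [integral_const_mul, integral_prod_mul]
  rw [ENNReal.ofReal_tsum_of_nonneg, ← ENNReal.tsum_mul_left]
  · refine tsum_congr fun k => ?_
    rw [← ENNReal.ofReal_mul (by positivity), show (4 : ENNReal) = ENNReal.ofReal 4 by simp,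
      ← ENNReal.ofReal_mul (by norm_num)]
    congr 1
    rw [hw]
    ring
  · exact fun k => mul_nonneg (hw0 k) (mul_self_nonneg _)
  · have := hcsum.summable
    simpa only [integral_const_mul, integral_prod_mul] using this

end Series

/-! ### Part 2: integration over the index set. -/

section ShortRangeDependence

variable {d : ℕ} {T : Set (EuclideanSpace ℝ (Fin d))}

/-- Under the condition on `ρ`, the integral over `T` is finite as soon as the integrand is finite
at the origin and the integral is finite over each set of times with `|ρ| < 1` almost everywhere. -/
theorem lintegral_indexMeasure_lt_top (h0 : 0 ∈ T) {ρ : T → ℝ} (hρ : RhoCondition ρ)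
    {F : T → ENNReal} (hF0 : F ⟨0, h0⟩ < ⊤)
    (hF : ∀ A : Set T, MeasurableSet A → (∀ᵐ t ∂((indexMeasure T).restrict A), |ρ t| < 1) →
      ∫⁻ t in A, F t ∂(indexMeasure T) < ⊤) :
    ∫⁻ t, F t ∂(indexMeasure T) < ⊤ := by
  by_cases hT : T.Countable
  -- Only the origin can violate `|ρ| < 1` here, and it has counting mass one.
  · have hA : MeasurableSet ({⟨0, h0⟩} : Set T) := measurableSet_singleton _
    rw [← lintegral_add_compl F hA, ENNReal.add_lt_top]
    refine ⟨?_, hF _ hA.compl ?_⟩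
    · rw [lintegral_singleton, indexMeasure, if_pos hT, Measure.count_singleton, mul_one]
      exact hF0
    · refine ae_restrict_of_forall_mem hA.compl fun t ht => hρ.1 hT t fun h => ht ?_
      exact Subtype.ext h
  · rw [← setLIntegral_univ]
    exact hF univ MeasurableSet.univ (by simpa using hρ.2 hT)

variable {Ω : Type*} [MeasurableSpace Ω] {P : Measure Ω}

/-- The summability hypothesis is used for the image of `μ.restrict S` under `G ∘ a`. This measure
lives on `G([0, ∞))`, where `genInv` recovers `a u`, even when `u` itself lies in a jump of `G` or
`G⁻(u) < 0`. -/
theorem isShortRangeDependent_comp_abs [IsProbabilityMeasure P] (h0 : 0 ∈ T) {Y : T → Ω → ℝ}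
    (hGauss : IsGaussianProcess Y P) (hMean : ∀ t, ∫ ω, Y t ω ∂P = 0)
    (hVar : ∀ t, variance (Y t) P = 1) (hMeas : AEMeasurable (corrFun h0 Y P) (indexMeasure T))
    (hρ : RhoCondition (corrFun h0 Y P)) {D : Set ℝ} (hD : Ici 0 ⊆ D) {G : ℝ → ℝ}
    (hG : StrictMonoOn G D ∨ StrictAntiOn G D)
    (hser : ∀ μ : Measure ℝ, IsFiniteMeasure μ → evenSeries D G (corrFun h0 Y P) μ < ⊤) :
    IsShortRangeDependent h0 (fun t ω => G |Y t ω|) P := by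
  intro μ hμ
  obtain ⟨S, a, hS, ha, hmono, hlev⟩ := exists_levels
    (hG.imp (fun h => h.mono hD) fun h => h.mono hD)
  have ham : AEMeasurable a (μ.restrict S) := hmono.elim
    (aemeasurable_restrict_of_monotoneOn hS) (aemeasurable_restrict_of_antitoneOn hS)
  have hlaw : ∀ t, P.map (Y t) = gaussianReal 0 1 := fun t =>
    map_eq_standard_gaussianReal (hGauss.hasGaussianLaw_eval t) (hMean t) (hVar t)
  set a' : ℝ → Ici (0 : ℝ) := fun u => ⟨a u, ha u⟩ with ha'
  have ham' : AEMeasurable a' (μ.restrict S) := ham.subtype_mk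
  have hb : ∀ k, bCoeff D G k (((μ.restrict S).map a').map fun x : Ici (0 : ℝ) => G x) =
      (∫ u in S, hermiteFun k (a u) * stdNormalDensity (a u) ∂μ) ^ 2 := by
    intro k
    rw [bCoeff_map hD hG, integral_map ham'
      (f := fun x : Ici (0 : ℝ) => hermiteFun k x * stdNormalDensity x)
      (Measurable.aestronglyMeasurable (by fun_prop))]
  have hfin := hser (((μ.restrict S).map a').map fun x : Ici (0 : ℝ) => G x) inferInstance
  simp only [evenSeries, hb] at hfin
  refine lintegral_indexMeasure_lt_top h0 hρ ?_ fun A hA hAρ => ?_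
  · calc _ ≤ ∫⁻ _ : ℝ × ℝ, ENNReal.ofReal 4 ∂(μ.prod μ) := lintegral_mono fun p =>
          ENNReal.ofReal_le_ofReal (abs_covariance_indicator_le _ _)
      _ < ⊤ := by
        rw [lintegral_const]
        exact ENNReal.mul_lt_top ENNReal.ofReal_lt_top (measure_lt_top _ _)
  · have hpt : ∀ t, |corrFun h0 Y P t| < 1 →
        ∫⁻ p : ℝ × ℝ, ENNReal.ofReal |indicatorCov h0 (fun t ω => G |Y t ω|) P t p.1 p.2|
            ∂(μ.prod μ) =
          4 * ∑' k : ℕ, ENNReal.ofReal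
            ((∫ u in S, hermiteFun (2 * (k + 1) - 1) (a u) * stdNormalDensity (a u) ∂μ) ^ 2 /
              ((2 * (k + 1)).factorial : ℝ)) *
            ENNReal.ofReal (corrFun h0 Y P t ^ (2 * (k + 1))) := by
      intro t ht
      have hcov := covariance_exceedance_eq (hGauss.aemeasurable ⟨0, h0⟩) (hGauss.aemeasurable t)
        (hlaw ⟨0, h0⟩) (hlaw t) hlev
      have hSS : MeasurableSet (S ×ˢ S) := hS.prod hS
      have hzero : ∫⁻ p in (S ×ˢ S)ᶜ,
          ENNReal.ofReal |indicatorCov h0 (fun t ω => G |Y t ω|) P t p.1 p.2| ∂(μ.prod μ) = 0 := by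
        rw [setLIntegral_congr_fun (g := fun _ => 0) hSS.compl, lintegral_zero]
        intro p hp
        have hp : p.1 ∉ S ∨ p.2 ∉ S := by
          by_contra! h
          exact hp ⟨h.1, h.2⟩
        simp only [indicatorCov, (hcov p.1 p.2).2 hp, abs_zero, ENNReal.ofReal_zero]
      rw [← lintegral_add_compl _ hSS, hzero, add_zero]
      rw [setLIntegral_congr_fun (g := fun p : ℝ × ℝ => ENNReal.ofReal
        |cov[fun ω => absGtInd (a p.1) (Y ⟨0, h0⟩ ω), fun ω => absGtInd (a p.2) (Y t ω); P]|) hSS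
        fun p hp => by simp only [indicatorCov, (hcov p.1 p.2).1 hp.1 hp.2], ← Measure.prod_restrict]
      exact lintegral_covariance_absGtInd hGauss.hasGaussianLaw_prodMk (hMean _) (hMean _)
        (hVar _) (hVar _) ht ha ham
    have hm : ∀ k : ℕ, AEMeasurable (fun t => ENNReal.ofReal (corrFun h0 Y P t ^ (2 * (k + 1))))
        (indexMeasure T) := fun k => (hMeas.pow_const _).ennreal_ofReal
    rw [lintegral_congr_ae (hAρ.mono hpt), lintegral_const_mul' _ _ (by simp),
      lintegral_tsum fun k => ((hm k).restrict.const_mul _)]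
    refine ENNReal.mul_lt_top (by simp) (lt_of_le_of_lt (ENNReal.tsum_le_tsum fun k => ?_) hfin)
    rw [lintegral_const_mul' _ _ ENNReal.ofReal_ne_top]
    gcongr
    exact Measure.restrict_le_self

end ShortRangeDependence

/-! ### Assembly of the two parts. -/

theorem mainTheorem4 {d : ℕ} {T : Set (EuclideanSpace ℝ (Fin d))} (hT : MeasurableSet T)
    (h0 : 0 ∈ T) {Ω : Type*} [MeasurableSpace Ω] (P : Measure Ω) [IsProbabilityMeasure P]
    (Y : T → Ω → ℝ) (hGauss : IsGaussianProcess Y P) (hStat : IsStationaryField Y P)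
    (hMean : ∀ t, ∫ ω, Y t ω ∂P = 0) (hVar : ∀ t, variance (Y t) P = 1)
    (hMeas : AEMeasurable (corrFun h0 Y P) (indexMeasure T))
    (hρ : RhoCondition (corrFun h0 Y P)) :
    (∀ G : ℝ → ℝ, (∀ x, ContinuousWithinAt G (Ici x) x) → (StrictMono G ∨ StrictAnti G) →
      -- Part 1
      (∀ f : ℝ → ℝ, Integrable f → (∀ x, 0 ≤ f x) → ContDiff ℝ 1 G → range G = univ →
        let μ : Measure ℝ := volume.withDensity (fun x => ENNReal.ofReal (f x))
        let g : ℝ → ℝ := fun x => deriv G x * f (G x)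
        (∀ k : ℕ, IntegrableOn (bIntegrand univ G k) (range G) μ ∧
          Integrable (fun x => g x * hermiteFun k x * stdNormalDensity x) ∧
          bCoeff univ G k μ = gaussInner g (hermiteFun k) ^ 2) ∧
        (∀ θ : ℝ, 0 < θ → θ < 1 →
          ∫⁻ ω, ENNReal.ofReal (|g (Y ⟨0, h0⟩ ω)| ^ (1 + θ)) ∂P < ⊤ →
          ∀ k : ℕ, IntegrableOn (bIntegrand univ G k) (range G) μ ∧
            Integrable (fun x => g x * hermiteFun k x * stdNormalDensity x)) ∧
        (Function.Even g → ∀ k : ℕ, Odd k → bCoeff univ G k μ = 0)) ∧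
      -- Part 2, `G` strictly monotone on the whole line
      ((∀ μ : Measure ℝ, IsFiniteMeasure μ → evenSeries univ G (corrFun h0 Y P) μ < ⊤) →
        IsShortRangeDependent h0 (fun t ω => G |Y t ω|) P)) ∧
    -- Part 2, `G` strictly monotone on the half-line only
    (∀ G : ℝ → ℝ, (∀ x, 0 ≤ x → ContinuousWithinAt G (Ici x) x) →
      (StrictMonoOn G (Ici 0) ∨ StrictAntiOn G (Ici 0)) →
      (∀ μ : Measure ℝ, IsFiniteMeasure μ → evenSeries (Ici 0) G (corrFun h0 Y P) μ < ⊤) →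
        IsShortRangeDependent h0 (fun t ω => G |Y t ω|) P) := by
  refine ⟨fun G _ hG => ⟨fun f hf hf0 hC hr => ?_, fun h => ?_⟩, fun G _ hG h =>
    isShortRangeDependent_comp_abs h0 hGauss hMean hVar hMeas hρ subset_rfl hG h⟩
  · have hd : Differentiable ℝ G := hC.differentiable one_ne_zero
    have hB := fun k => (integrable_bIntegrand_withDensity hG hr hf k).integrableOn (s := range G)
    have hI := fun k => integrable_deriv_mul_comp hG hd hr hf hf0 k
    have hE := fun k => bCoeff_withDensity hG hd hr hf hf0 k
    refine ⟨fun k => ⟨hB k, hI k, hE k⟩, fun _ _ _ _ k => ⟨hB k, hI k⟩, fun heven k hk => ?_⟩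
    rw [hE k, gaussInner_hermiteFun_eq_zero_of_even heven hk]
    norm_num
  · exact isShortRangeDependent_comp_abs h0 hGauss hMean hVar hMeas hρ (subset_univ _)
      (by simpa using hG) h
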